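/- Let $\mathcal C$ be a semisimple abelian $\mathbb C$-linear category with finite-dimensional morphism spaces, carrying a rigid (left and right duals) braided monoidal structure with $\mathbb C$-bilinear tensor product, simple unit object $\mathbf 1$, braiding $R$, and a balancing $\theta$ (a natural automorphism of the identity functor with $\theta_{X\otimes Y}=R_{YX}R_{XY}(\theta_X\otimes\theta_Y)$). Let $(A,\mu,\iota_A)$ be a rigid commutative associative unital algebra in $\mathcal C$: $\dim\operatorname{Hom}_{\mathcal C}(\mathbf 1,A)=1$; the pairing $\varepsilon_A\mu\colon A\otimes A\to\mathbf 1$ is nondegenerate, where $\varepsilon_A\colon A\to\mathbf 1$ satisfies $\varepsilon_A\iota_A=\mathrm{id}$; and $\dim_{\mathcal C}A\neq0$. Assume $\theta_A=\mathrm{id}$. Let a finite group $G$ act faithfully on $A$ by algebra automorphisms $\pi_g$ with $A^G=\mathbf 1$. Let $\operatorname{Rep}A$ be the category of $A$-modules $(X,\mu_X\colon A\otimes X\to X)$ in $\mathcal C$, and let $\operatorname{Rep}^0A$ be its full subcategory of modules with $\mu_XR_{XA}R_{AX}=\mu_X$. For $A$-modules $X,Y$ let $X\otimes_AY=X\otimes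 Y/\operatorname{im}(\mu_1-\mu_2)$, where $\mu_1=\mu_X\otimes\mathrm{id}$ and $\mu_2=(\mathrm{id}\otimes\mu_Y)(R_{AX}\otimes\mathrm{id})\colon A\otimes X\otimes Y\to X\otimes Y$, with the $A$-action induced by $\mu_1$. Let $\mathcal D$ be the category whose objects are pairs $(X,\varphi_X)$, where $X\in\operatorname{Rep}A$ and $\varphi_X(g)\colon X\to X$ $(g\in G)$ are $\mathcal C$-morphisms with $\varphi_X(g)\mu_X=\mu_X(\pi_g\otimes\varphi_X(g))$, $\varphi_X(g_1)\varphi_X(g_2)=\varphi_X(g_1g_2)$ and $\varphi_X(1)=\mathrm{id}$; morphisms are the $A$-module morphisms commuting with all $\varphi(g)$. Let $\mathcal D^0\subset\mathcal D$ be the full subcategory of the objects with $X\in\operatorname{Rep}^0A$. A tensor category over $\mathbb C$ means an abelian $\mathbb C$-linear monoidal category with bilinear tensor product, finite-dimensional morphism spaces and $\operatorname{End}(\mathbf 1)=\mathbb C$. **Proposition.** 1. $\mathcal D$, with addition and scalar multiplication of morphisms as in $\mathcal C$, has a natural structure of a rigid tensor category. Its tensor product is $(X,\varphi_X)\otimes(Y,\varphi_Y)=(X\otimes_AY,\varphi_X\otimes\varphi_Y)$,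 its unit object is $(A,\pi)$, and the tensor product of morphisms, the associativity isomorphisms and the unit isomorphisms are induced by those of $\mathcal C$ along the projections $X\otimes Y\to X\otimes_AY$. The dual of $(X,\varphi_X)$ is $(X^*,\ g\mapsto\varphi_X(g^{-1})^*)$, where $X^*$ is the dual of $X$ in $\mathcal C$ (with evaluation $e_X\colon X^*\otimes X\to\mathbf 1$), and the evaluation $X^*\otimes_AX\to A$ in $\mathcal D$ composed with the projection $X^*\otimes X\to X^*\otimes_AX$ and with $\varepsilon_A$ is $e_X$. 2. $\mathcal D^0$ contains the unit object, is closed under tensor products and left and right duals in $\mathcal D$, and with the tensor structure of $\mathcal D$ it is a balanced rigid braided tensor category. Its braiding is inherited from $\mathcal C$: it is the morphism $X\otimes_AY\to Y\otimes_AX$ induced by $R_{XY}$; and the underlying $\mathcal C$-morphism of its balancing on $(X,\varphi_X)$ is $\theta_X$. If moreover $\theta_{X^*}=\theta_X^*$ for all $X\in\mathcal C$, then the same identity holds for the balancing of $\mathcal D^0$. -/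

import Mathlib

open CategoryTheory MonoidalCategory MonObj Limits

universe v u w

/-- A balancing (twist) on a braided monoidal category: a natural automorphism `θ` of the identity
functor with `θ_{X ⊗ Y} = R_{YX} R_{XY} (θ_X ⊗ θ_Y)`. -/
structure BraidedTwist (C : Type u) [Category.{v} C] [MonoidalCategory C] [BraidedCategory C] where
  θ : 𝟭 C ≅ 𝟭 C
  tensor : ∀ X Y : C, (θ.hom.app (X ⊗ Y) : X ⊗ Y ⟶ X ⊗ Y) =
    ((θ.hom.app X : X ⟶ X) ⊗ₘ (θ.hom.app Y : Y ⟶ Y)) ≫ (β_ X Y).hom ≫ (β_ Y X).hom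

namespace BraidedTwist

variable {C : Type u} [Category.{v} C] [MonoidalCategory C] [BraidedCategory C]

/-- The component `θ_X : X ⟶ X`. -/
def app (t : BraidedTwist C) (X : C) : X ⟶ X := t.θ.hom.app X

/-- Compatibility of the twist with duality: `θ_{X^*} = (θ_X)^*`. -/
def IsRibbon [RightRigidCategory C] (t : BraidedTwist C) : Prop :=
  ∀ X : C, t.app (Xᘁ) = (t.app X)ᘁ

/-- The (quantum) dimension of `X`, an endomorphism of the unit object:
`1 ⟶ X ⊗ X^* ⟶ X ⊗ X^* ⟶ X^* ⊗ X ⟶ 1`, the middle maps being `θ_X ⊗ id` and the braiding. -/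
def dim [RightRigidCategory C] (t : BraidedTwist C) (X : C) : 𝟙_ C ⟶ 𝟙_ C :=
  η_ X (Xᘁ) ≫ (t.app X ▷ (Xᘁ)) ≫ (β_ X (Xᘁ)).hom ≫ ε_ X (Xᘁ)

end BraidedTwist

attribute [local instance] Abelian.hasFiniteBiproducts in
/-- Semisimplicity: every object is a finite direct sum of simple objects. -/
def IsSemisimpleCategory (C : Type u) [Category.{v} C] [Abelian C] : Prop :=
  ∀ X : C, ∃ (n : ℕ) (S : Fin n → C), (∀ i, Simple (S i)) ∧ Nonempty (X ≅ ⨁ S)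

/-- A `ℂ`-linear monoidal category is a tensor category over `ℂ`: it is abelian, the tensor product
is bilinear, the morphism spaces are finite-dimensional, and `End(1) = ℂ`. -/
structure IsTensorCategory (D : Type u) [Category.{v} D] [inst : Preadditive D] [Linear ℂ D]
    [MonoidalCategory D] : Prop where
  abelian : ∃ ab : Abelian D, ab.toPreadditive = inst
  bilinear : ∃ _ : MonoidalPreadditive D, MonoidalLinear ℂ D
  finiteDimensional : ∀ X Y : D, FiniteDimensional ℂ (X ⟶ Y)
  unit : Module.finrank ℂ (𝟙_ D ⟶ 𝟙_ D) = 1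

section Setup

variable {C : Type u} [Category.{v} C] [MonoidalCategory C]

section Algebra

variable [Abelian C] [Linear ℂ C] [BraidedCategory C] [RightRigidCategory C]

/-- `A` (an associative unital algebra) is a rigid commutative algebra in `C`: it is commutative,
contains the unit object exactly once, the pairing `A ⊗ A ⟶ A ⟶ 1` given by
multiplication and the projection `ε` normalized by `ε ∘ ι_A = id` is nondegenerate, and
`dim A ≠ 0`. -/
structure IsRigidCommAlgebra (t : BraidedTwist C) (A : C) [MonObj A] (ε : A ⟶ 𝟙_ C) : Prop where
  comm : IsCommMonObj A
  haploid : Module.finrank ℂ (𝟙_ C ⟶ A) = 1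
  counit : η[A] ≫ ε = 𝟙 (𝟙_ C)
  nondegenerate : ∃ e : ExactPairing A A, e.evaluation' = μ[A] ≫ ε
  dim_ne_zero : t.dim A ≠ 0

end Algebra

/-- An action of the group `G` on the algebra `A` by algebra automorphisms `π_g`. -/
structure AlgAction (G : Type w) [Group G] (A : C) [MonObj A] where
  π : G →* End A
  isMonHom : ∀ g, IsMonHom (π g : A ⟶ A)

variable {G : Type w} [Group G] {A : C} [MonObj A]

/-- `A^G = 1`: the unit `ι_A : 1 ⟶ A` exhibits `1` as the object of invariants of `A`. -/
def AlgAction.InvariantsEqUnit (π : AlgAction G A) : Prop :=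
  ∀ (Z : C) (f : Z ⟶ A), (∀ g, f ≫ (π.π g : A ⟶ A) = f) → ∃! k : Z ⟶ 𝟙_ C, k ≫ η[A] = f

/-- The action `A ⊗ X ⟶ X` of `A` on an `A`-module `X`. Here `Mod C A` is the category `Rep A`. -/
abbrev CategoryTheory.Mod.act (X : Mod C A) : A ⊗ X.X ⟶ X.X := X.mod.smul

section RelativeTensor

variable [BraidedCategory C]

/-- The object property defining `Rep⁰ A ⊆ Rep A`: `μ_X ∘ R_{XA} ∘ R_{AX} = μ_X`. -/
def CategoryTheory.Mod.IsLocal (X : Mod C A) : Prop :=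
  (β_ A X.X).hom ≫ (β_ X.X A).hom ≫ X.act = X.act

/-- `μ₁ : A ⊗ (X ⊗ Y) ⟶ X ⊗ Y`, the action of `A` on the first factor. -/
def relAct₁ (X Y : Mod C A) : A ⊗ (X.X ⊗ Y.X) ⟶ X.X ⊗ Y.X :=
  (α_ A X.X Y.X).inv ≫ (X.act ▷ Y.X)

/-- `μ₂ : A ⊗ (X ⊗ Y) ⟶ X ⊗ Y`, the action of `A` on the second factor, after moving `A` past
the first one by the braiding. -/
def relAct₂ (X Y : Mod C A) : A ⊗ (X.X ⊗ Y.X) ⟶ X.X ⊗ Y.X :=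
  (α_ A X.X Y.X).inv ≫ ((β_ A X.X).hom ▷ Y.X) ≫ (α_ X.X A Y.X).hom ≫ (X.X ◁ Y.act)

/-- `p : X ⊗ Y ⟶ Z` exhibits the `A`-module `Z` as `X ⊗_A Y`, i.e. as the quotient
`X ⊗ Y / im (μ₁ - μ₂)` with the `A`-module structure induced by `μ₁`. -/
structure IsRelTensor (X Y Z : Mod C A) (p : X.X ⊗ Y.X ⟶ Z.X) : Prop where
  balanced : relAct₁ X Y ≫ p = relAct₂ X Y ≫ p
  isColimit : Nonempty (IsColimit (Cofork.ofπ p balanced))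
  act : (A ◁ p) ≫ Z.act = relAct₁ X Y ≫ p

end RelativeTensor

/-- An object `(X, φ_X)` of the category `𝒟`: an `A`-module `X` with an action `φ_X` of `G` by
`C`-endomorphisms of `X` such that `φ_X(g) ∘ μ_X = μ_X ∘ (π_g ⊗ φ_X(g))`. (In `End`, the product
`a * b` is `a ∘ b`.) -/
structure EquivMod (π : AlgAction G A) where
  M : Mod C A
  φ : G →* End M.X
  compat : ∀ g, M.act ≫ (φ g : M.X ⟶ M.X) = ((π.π g : A ⟶ A) ⊗ₘ (φ g : M.X ⟶ M.X)) ≫ M.act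

namespace EquivMod

variable {π : AlgAction G A}

/-- The underlying object of `C`. -/
abbrev X (V : EquivMod π) : C := V.M.X

/-- The `C`-morphism `φ_X(g) : X ⟶ X`. -/
abbrev ρ (V : EquivMod π) (g : G) : V.X ⟶ V.X := V.φ g

/-- A morphism of `𝒟`: a morphism of `A`-modules which commutes with all `φ(g)`. -/
@[ext]
structure Hom (V W : EquivMod π) where
  hom : V.M ⟶ W.M
  comm : ∀ g, V.ρ g ≫ hom.hom = hom.hom ≫ W.ρ g

/-- The category `𝒟`. -/
instance : Category (EquivMod π) where
  Hom V W := Hom V W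
  id V := ⟨𝟙 V.M, fun g => by simp⟩
  comp f g := ⟨f.hom ≫ g.hom, fun x => by
    rw [Mod.comp_hom', ← Category.assoc, f.comm, Category.assoc, g.comm, Category.assoc]⟩

/-- The `C`-morphism underlying a morphism of `𝒟`. -/
def toC {V W : EquivMod π} (f : V ⟶ W) : V.X ⟶ W.X := f.hom.hom

@[ext]
theorem hom_ext' {V W : EquivMod π} {f g : V ⟶ W} (h : toC f = toC g) : f = g :=
  Hom.ext (Mod.hom_ext _ _ h)

@[simp]
theorem toC_id (V : EquivMod π) : toC (𝟙 V) = 𝟙 V.X := rfl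

@[simp]
theorem toC_comp {U V W : EquivMod π} (f : U ⟶ V) (g : V ⟶ W) :
    toC (f ≫ g) = toC f ≫ toC g := rfl

/-- The object `A = (A, π)` of `𝒟`. -/
def algObj (π : AlgAction G A) : EquivMod π where
  M := { X := A, mod := ModObj.regular A }
  φ := π.π
  compat g := (π.isMonHom g).mul_hom

section Linear

variable [Preadditive C] [Linear ℂ C] [MonoidalPreadditive C] [MonoidalLinear ℂ C]

/-- The morphisms `V ⟶ W` of `𝒟` as a subspace of the space of `C`-morphisms. -/
def homSubmodule (V W : EquivMod π) : Submodule ℂ (V.X ⟶ W.X) where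
  carrier := {f | V.M.act ≫ f = (A ◁ f) ≫ W.M.act ∧ ∀ g, V.ρ g ≫ f = f ≫ W.ρ g}
  zero_mem' := by simp
  add_mem' := by
    rintro a b ⟨h1, h2⟩ ⟨h3, h4⟩
    refine ⟨?_, fun g => ?_⟩
    · rw [Preadditive.comp_add, h1, h3, MonoidalPreadditive.whiskerLeft_add,
        Preadditive.add_comp]
    · rw [Preadditive.comp_add, h2, h4, Preadditive.add_comp]
  smul_mem' := by
    rintro c a ⟨h1, h2⟩
    refine ⟨?_, fun g => ?_⟩
    · rw [Linear.comp_smul, h1, MonoidalLinear.whiskerLeft_smul, Linear.smul_comp]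
    · rw [Linear.comp_smul, h2, Linear.smul_comp]

/-- Morphisms of `𝒟` are the elements of `homSubmodule`. -/
def homEquiv (V W : EquivMod π) : (V ⟶ W) ≃ homSubmodule V W where
  toFun f := ⟨toC f, f.hom.isModHom.smul_hom, f.comm⟩
  invFun f := ⟨Mod.Hom.mk' f.1 f.2.1, f.2.2⟩
  left_inv _ := rfl
  right_inv _ := rfl

/-- `𝒟` is preadditive, with addition of morphisms as in `C`. -/
instance : Preadditive (EquivMod π) where
  homGroup V W := (homEquiv V W).addCommGroup
  add_comp _ _ _ f g h := hom_ext' (Preadditive.add_comp _ _ _ (toC f) (toC g) (toC h))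
  comp_add _ _ _ f g h := hom_ext' (Preadditive.comp_add _ _ _ (toC f) (toC g) (toC h))

/-- `𝒟` is `ℂ`-linear, with scalar multiplication of morphisms as in `C`. -/
instance : Linear ℂ (EquivMod π) where
  homModule V W := (homEquiv V W).module ℂ
  smul_comp _ _ _ r f g := hom_ext' (Linear.smul_comp _ _ _ r (toC f) (toC g))
  comp_smul _ _ _ f r g := hom_ext' (Linear.comp_smul _ _ _ (toC f) r (toC g))

end Linear

variable [BraidedCategory C]

/-- `𝒟⁰` is the full subcategory of the `(X, φ_X)` with `X` in `Rep⁰ A`. -/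
def isLocal (π : AlgAction G A) : ObjectProperty (EquivMod π) := fun V => V.M.IsLocal

/-- A monoidal structure on `𝒟`, with projections `p : X ⊗ Y ⟶ X ⊗_A Y` and an identification `e`
of its unit object with `(A, π)`, is the natural one: the tensor product is
`(X ⊗_A Y, φ_X ⊗ φ_Y)`, and the tensor product of morphisms, the associator and the unitors are
induced by those of `C`. -/
structure IsNaturalTensor [MonoidalCategory (EquivMod π)]
    (p : ∀ V W : EquivMod π, V.X ⊗ W.X ⟶ (V ⊗ W).X) (e : 𝟙_ (EquivMod π) ≅ algObj π) : Prop where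
  tensor : ∀ V W, IsRelTensor V.M W.M (V ⊗ W).M (p V W)
  action : ∀ V W g, p V W ≫ (V ⊗ W).ρ g = (V.ρ g ⊗ₘ W.ρ g) ≫ p V W
  hom : ∀ {V V' W W' : EquivMod π} (f : V ⟶ V') (g : W ⟶ W'),
    p V W ≫ toC (f ⊗ₘ g) = (toC f ⊗ₘ toC g) ≫ p V' W'
  associator : ∀ U V W, (p U V ▷ W.X) ≫ p (U ⊗ V) W ≫ toC (α_ U V W).hom =
    (α_ U.X V.X W.X).hom ≫ (U.X ◁ p V W) ≫ p U (V ⊗ W)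
  leftUnitor : ∀ V, ((η[A] ≫ toC e.inv) ▷ V.X) ≫ p (𝟙_ _) V ≫ toC (λ_ V).hom = (λ_ V.X).hom
  rightUnitor : ∀ V, (V.X ◁ (η[A] ≫ toC e.inv)) ≫ p V (𝟙_ _) ≫ toC (ρ_ V).hom = (ρ_ V.X).hom

/-- `d` identifies `W` with `(X^*, φ_X(g⁻¹)^*)` for `V = (X, φ_X)`, where `X^*` is the dual of `X`
in `C` and `ev : W ⊗ V ⟶ 1` is a pairing in `𝒟` corresponding to the evaluation
`X^* ⊗ X ⟶ 1` of `C` under `ε : A ⟶ 1`; the latter condition also determines the action of `A`. -/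
structure IsNaturalDual [RightRigidCategory C] [MonoidalCategory (EquivMod π)]
    (p : ∀ V W : EquivMod π, V.X ⊗ W.X ⟶ (V ⊗ W).X) (e : 𝟙_ (EquivMod π) ≅ algObj π)
    (ε : A ⟶ 𝟙_ C) (V W : EquivMod π) (ev : W ⊗ V ⟶ 𝟙_ (EquivMod π))
    (d : W.X ≅ (V.X)ᘁ) : Prop where
  action : ∀ g, W.ρ g ≫ d.hom = d.hom ≫ (V.ρ g⁻¹)ᘁ
  evaluation : p W V ≫ toC ev ≫ toC e.hom ≫ ε = (d.hom ▷ V.X) ≫ ε_ V.X (V.X)ᘁ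

end EquivMod

end Setup

/-!
Let `μ_X' = μ_X ∘ R_{AX}⁻¹` be the right action of `A` on an `A`-module `X`. Then `X ⊗_A Y` is the
quotient of `X ⊗ Y` by the relation `xa ⊗ y = x ⊗ ay`, and a morphism out of it is a *balanced*
morphism out of `X ⊗ Y`. Since `C` is rigid, tensoring preserves these quotients, so that
associator, unitors and coherence descend from `C`. The construction is functorial for maps which
are only semilinear along an endomorphism of `A`; applied to the operators `φ_X(g)`, this gives the
`G`-action on tensor products and the equivariance of all structure maps at once.

Limits and colimits in `𝒟` and `𝒟⁰` are those of `C`, so both categories are abelian.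

The pairing `ε μ` makes `A` a Frobenius algebra, so that `A`-linear maps `Z ⟶ A` correspond to
morphisms `Z ⟶ 1` of `C` by composition with `ε`. As `A` contains `1` exactly once, `ε` is the only
functional with `ε ι = 1`; hence it is `G`-invariant. The dual of `X` in `C` carries the transposed
action, for which the evaluation `X* ⊗ X ⟶ 1` is balanced and invariant; it therefore lifts to
`X* ⊗_A X ⟶ A`. With the coevaluation of `C` extended to `A ⟶ X ⊗_A X*`, the zigzag identities hold
up to the scalar `c` in `μ ∘ coev_A = c ι`, and `c = dim A ≠ 0` because `θ_A = 1`.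

For `X` local both braidings define the same right action, which is what makes `R_{XY}` compatible
with the relations. That the dual of a local module is local follows from commutativity of `A`: for
any module `Z` and `f : Z ⟶ 1` one has `f μ_Z = ε μ (id ⊗ φ)` with `φ : Z ⟶ A` linear, so `f μ_Z` is
unchanged by the double braiding of `A` with `Z`. For `Z = X* ⊗_A X` and `f` the evaluation, this
says that the double braidings of `A` with the two factors cancel.
-/

section ModuleActions

variable {C : Type u} [Category.{v} C] [MonoidalCategory C] {A : C} [MonObj A]

theorem one_act (V : Mod C A) : η[A] ▷ V.X ≫ V.act = (λ_ V.X).hom :=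
  ModObj.one_smul_self A V.X

theorem mul_act (V : Mod C A) :
    μ[A] ▷ V.X ≫ V.act = (α_ A A V.X).hom ≫ A ◁ V.act ≫ V.act :=
  ModObj.mul_smul_self A V.X

theorem act_act (V : Mod C A) :
    A ◁ V.act ≫ V.act = (α_ A A V.X).inv ≫ μ[A] ▷ V.X ≫ V.act :=
  ModObj.mul_smul_self_flip V.X

variable (A) in
/-- The algebra `A` as a module over itself: `Mod.regular A`, made reducible so that its carrier is
`A` on the nose. -/
abbrev regularMod : Mod C A := { X := A, mod := ModObj.regular A }

theorem regularMod_act : (regularMod A).act = μ[A] := rfl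

/-- `f` is semilinear along the endomorphism `a` of `A`: `f (x v) = a(x) f(v)`. Module morphisms
are the case `a = 𝟙 A`; the operators `φ_X(g)` are the case `a = π_g`. -/
def IsSemilinear (a : A ⟶ A) {V W : Mod C A} (f : V.X ⟶ W.X) : Prop :=
  V.act ≫ f = (a ⊗ₘ f) ≫ W.act

namespace IsSemilinear

theorem id_iff {V W : Mod C A} {f : V.X ⟶ W.X} :
    IsSemilinear (𝟙 A) f ↔ V.act ≫ f = A ◁ f ≫ W.act := by
  rw [IsSemilinear, id_tensorHom]

theorem of_hom {V W : Mod C A} (f : V ⟶ W) : IsSemilinear (𝟙 A) f.hom :=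
  id_iff.2 f.isModHom.smul_hom

theorem id (V : Mod C A) : IsSemilinear (𝟙 A) (𝟙 V.X) :=
  of_hom (𝟙 V)

theorem regular (a : A ⟶ A) [IsMonHom a] :
    IsSemilinear (V := regularMod A) (W := regularMod A) a a :=
  IsMonHom.mul_hom a

theorem comp {a b : A ⟶ A} {U V W : Mod C A} {f : U.X ⟶ V.X} {g : V.X ⟶ W.X}
    (hf : IsSemilinear a f) (hg : IsSemilinear b g) : IsSemilinear (a ≫ b) (f ≫ g) := by
  rw [IsSemilinear, reassoc_of% hf, hg, tensorHom_comp_tensorHom_assoc]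

theorem whiskerRight_act {a : A ⟶ A} {V V' : Mod C A} {f : V.X ⟶ V'.X} (hf : IsSemilinear a f)
    {Z Z' : C} (g : Z ⟶ Z') :
    V.act ▷ Z ≫ (f ⊗ₘ g) = ((a ⊗ₘ f) ⊗ₘ g) ≫ V'.act ▷ Z' := by
  rw [whiskerRight_comp_tensorHom, hf, tensorHom_comp_whiskerRight]

theorem whiskerLeft_act {a : A ⟶ A} {W W' : Mod C A} {g : W.X ⟶ W'.X} (hg : IsSemilinear a g)
    {Z Z' : C} (f : Z ⟶ Z') :
    Z ◁ W.act ≫ (f ⊗ₘ g) = (f ⊗ₘ (a ⊗ₘ g)) ≫ Z' ◁ W'.act := by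
  rw [whiskerLeft_comp_tensorHom, hg, tensorHom_comp_whiskerLeft]

theorem ext_one {W : Mod C A} {f g : A ⟶ W.X} (hf : IsSemilinear (V := regularMod A) (𝟙 A) f)
    (hg : IsSemilinear (V := regularMod A) (𝟙 A) g) (h : η[A] ≫ f = η[A] ≫ g) : f = g := by
  have eq_one_comp {k : A ⟶ W.X} (hk : IsSemilinear (V := regularMod A) (𝟙 A) k) :
      k = (ρ_ A).inv ≫ A ◁ (η[A] ≫ k) ≫ W.act := by
    have mul_comp : μ[A] ≫ k = A ◁ k ≫ W.act := id_iff.1 hk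
    rw [whiskerLeft_comp_assoc, ← mul_comp, mul_one_assoc, Iso.inv_hom_id_assoc]
  rw [eq_one_comp hf, h, ← eq_one_comp hg]

end IsSemilinear

variable [BraidedCategory C]

/-- The right action of `A` on a left module: the two are exchanged by the braiding `R_{AX}`, which
is the convention of the second action `μ₂` defining `X ⊗_A Y`. -/
def rightAct (V : Mod C A) : V.X ⊗ A ⟶ V.X := (β_ A V.X).inv ≫ V.act

theorem braiding_rightAct (V : Mod C A) : (β_ A V.X).hom ≫ rightAct V = V.act := by
  rw [rightAct, Iso.hom_inv_id_assoc]

theorem one_rightAct (V : Mod C A) : V.X ◁ η[A] ≫ rightAct V = (ρ_ V.X).hom := by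
  rw [rightAct, BraidedCategory.braiding_inv_naturality_right_assoc, one_act]
  simp

theorem IsSemilinear.rightAct {a : A ⟶ A} {V W : Mod C A} {f : V.X ⟶ W.X}
    (hf : IsSemilinear a f) : rightAct V ≫ f = (f ⊗ₘ a) ≫ rightAct W := by
  rw [_root_.rightAct, _root_.rightAct, Category.assoc, hf,
    BraidedCategory.braiding_inv_naturality_assoc]

variable [IsCommMonObj A]

theorem act_rightAct (V : Mod C A) :
    V.act ▷ A ≫ rightAct V = (α_ A V.X A).hom ≫ A ◁ rightAct V ≫ V.act := by
  rw [← cancel_epi (β_ A (A ⊗ V.X)).hom, ← BraidedCategory.braiding_naturality_right_assoc,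
    braiding_rightAct, BraidedCategory.braiding_tensor_right_hom]
  simp only [Category.assoc, Iso.inv_hom_id_assoc]
  rw [← whiskerLeft_comp_assoc, braiding_rightAct, act_act, Iso.hom_inv_id_assoc,
    ← comp_whiskerRight_assoc, IsCommMonObj.mul_comm]

theorem mul_rightAct (V : Mod C A) :
    V.X ◁ μ[A] ≫ rightAct V = (α_ V.X A A).inv ≫ rightAct V ▷ A ≫ rightAct V := by
  rw [← cancel_epi (β_ (A ⊗ A) V.X).hom, ← BraidedCategory.braiding_naturality_left_assoc,
    braiding_rightAct, BraidedCategory.braiding_tensor_left_hom]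
  simp only [Category.assoc, Iso.hom_inv_id_assoc]
  rw [← comp_whiskerRight_assoc, braiding_rightAct, act_rightAct, Iso.inv_hom_id_assoc,
    ← whiskerLeft_comp_assoc, braiding_rightAct, mul_act]

theorem regularMod_rightAct : rightAct (regularMod A) = μ[A] := by
  rw [← cancel_epi (β_ A A).hom]
  exact (braiding_rightAct (regularMod A)).trans (IsCommMonObj.mul_comm A).symm

end ModuleActions

section Balanced

variable {C : Type u} [Category.{v} C] [MonoidalCategory C] [BraidedCategory C] {A : C} [MonObj A]

/-- A morphism out of `V ⊗ W` is balanced if it is middle-linear over `A`: it equalizes the right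
action on `V` and the left action on `W`, and so factors through `V ⊗_A W`. -/
def IsBalanced (V W : Mod C A) {Z : C} (f : V.X ⊗ W.X ⟶ Z) : Prop :=
  rightAct V ▷ W.X ≫ f = (α_ V.X A W.X).hom ≫ V.X ◁ W.act ≫ f

theorem isBalanced_iff {V W : Mod C A} {Z : C} {f : V.X ⊗ W.X ⟶ Z} :
    IsBalanced V W f ↔ relAct₁ V W ≫ f = relAct₂ V W ≫ f := by
  rw [IsBalanced, relAct₁, relAct₂, ← cancel_epi ((α_ A V.X W.X).inv ≫ (β_ A V.X).hom ▷ W.X)]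
  simp only [Category.assoc, ← comp_whiskerRight_assoc, braiding_rightAct]

theorem IsBalanced.tensorHom_comp {a : A ⟶ A} {V V' W W' : Mod C A} {f : V.X ⟶ V'.X}
    {g : W.X ⟶ W'.X} (hf : IsSemilinear a f) (hg : IsSemilinear a g) {Z : C}
    {p : V'.X ⊗ W'.X ⟶ Z} (hp : IsBalanced V' W' p) : IsBalanced V W ((f ⊗ₘ g) ≫ p) := by
  rw [IsBalanced, whiskerRight_comp_tensorHom_assoc, hf.rightAct,
    ← tensorHom_comp_whiskerRight_assoc, hp, reassoc_of% hg.whiskerLeft_act f,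
    associator_naturality_assoc]

end Balanced

section RelativeTensor

variable {C : Type u} [Category.{v} C] [MonoidalCategory C]

theorem exists_whiskerLeft_desc (Z : C)
    [PreservesColimitsOfShape WalkingParallelPair (tensorLeft Z)] {X Y Q : C} {f g : X ⟶ Y}
    {q : Y ⟶ Q} {w : f ≫ q = g ≫ q} (hq : IsColimit (Cofork.ofπ q w)) {T : C} (k : Z ⊗ Y ⟶ T)
    (hk : Z ◁ f ≫ k = Z ◁ g ≫ k) : ∃ h : Z ⊗ Q ⟶ T, Z ◁ q ≫ h = k :=
  ⟨_, (Cofork.IsColimit.desc' (isColimitCoforkMapOfIsColimit (tensorLeft Z) w hq) k hk).2⟩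

theorem exists_whiskerRight_desc (Z : C)
    [PreservesColimitsOfShape WalkingParallelPair (tensorRight Z)] {X Y Q : C} {f g : X ⟶ Y}
    {q : Y ⟶ Q} {w : f ≫ q = g ≫ q} (hq : IsColimit (Cofork.ofπ q w)) {T : C} (k : Y ⊗ Z ⟶ T)
    (hk : f ▷ Z ≫ k = g ▷ Z ≫ k) : ∃ h : Q ⊗ Z ⟶ T, q ▷ Z ≫ h = k :=
  ⟨_, (Cofork.IsColimit.desc' (isColimitCoforkMapOfIsColimit (tensorRight Z) w hq) k hk).2⟩

instance isRegularEpi_whiskerLeft (Z : C)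
    [PreservesColimitsOfShape WalkingParallelPair (tensorLeft Z)] {X Y : C} (f : X ⟶ Y)
    [IsRegularEpi f] : IsRegularEpi (Z ◁ f) :=
  ⟨⟨{ W := Z ⊗ IsRegularEpi.W f
      left := Z ◁ IsRegularEpi.left f
      right := Z ◁ IsRegularEpi.right f
      w := by rw [← whiskerLeft_comp, ← whiskerLeft_comp, IsRegularEpi.w]
      isColimit := isColimitCoforkMapOfIsColimit (tensorLeft Z) _ (IsRegularEpi.isColimit f) }⟩⟩

instance isRegularEpi_whiskerRight (Z : C)
    [PreservesColimitsOfShape WalkingParallelPair (tensorRight Z)] {X Y : C} (f : X ⟶ Y)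
    [IsRegularEpi f] : IsRegularEpi (f ▷ Z) :=
  ⟨⟨{ W := IsRegularEpi.W f ⊗ Z
      left := IsRegularEpi.left f ▷ Z
      right := IsRegularEpi.right f ▷ Z
      w := by rw [← comp_whiskerRight, ← comp_whiskerRight, IsRegularEpi.w]
      isColimit := isColimitCoforkMapOfIsColimit (tensorRight Z) _ (IsRegularEpi.isColimit f) }⟩⟩

variable [BraidedCategory C]

instance (Z : C) [PreservesColimitsOfShape WalkingParallelPair (tensorLeft Z)] :
    PreservesColimitsOfShape WalkingParallelPair (tensorRight Z) :=
  preservesColimitsOfShape_of_natIso (BraidedCategory.tensorLeftIsoTensorRight Z)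

variable {A : C} [MonObj A] [IsCommMonObj A]

section Quotient

variable {V W : Mod C A} {Q : C} {p : V.X ⊗ W.X ⟶ Q}
  {w : rightAct V ▷ W.X ≫ p = ((α_ V.X A W.X).hom ≫ V.X ◁ W.act) ≫ p}

theorem exists_quotient_act [PreservesColimitsOfShape WalkingParallelPair (tensorLeft A)]
    (hp : IsColimit (Cofork.ofπ p w)) :
    ∃ m : A ⊗ Q ⟶ Q, A ◁ p ≫ m = (α_ A V.X W.X).inv ≫ V.act ▷ W.X ≫ p := by
  refine exists_whiskerLeft_desc A hp _ ?_
  calc _ = 𝟙 _ ⊗≫ (A ◁ rightAct V ≫ V.act) ▷ W.X ≫ p := by monoidal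
    _ = 𝟙 _ ⊗≫ (V.act ▷ A ≫ rightAct V) ▷ W.X ≫ p := by rw [act_rightAct]; monoidal
    _ = 𝟙 _ ⊗≫ V.act ▷ A ▷ W.X ≫ rightAct V ▷ W.X ≫ p := by monoidal
    _ = 𝟙 _ ⊗≫ (V.act ▷ (A ⊗ W.X) ≫ V.X ◁ W.act) ≫ p := by rw [w]; monoidal
    _ = _ := by rw [← whisker_exchange]; monoidal

/-- The `A`-module structure induced by `μ₁` on the quotient `Q = V ⊗ W / im (μ₁ - μ₂)`. -/
noncomputable abbrev quotientModObj
    [∀ Z : C, PreservesColimitsOfShape WalkingParallelPair (tensorLeft Z)]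
    (hp : IsColimit (Cofork.ofπ p w)) : ModObj A Q where
  smul := (exists_quotient_act hp).choose
  one_smul := by
    have h := (exists_quotient_act hp).choose_spec
    set m := (exists_quotient_act hp).choose
    change η[A] ▷ _ ≫ m = (λ_ _).hom
    have : IsRegularEpi p := ⟨⟨⟨_, _, _, _, hp⟩⟩⟩
    rw [← cancel_epi (𝟙_ C ◁ p), whisker_exchange_assoc, h]
    calc _ = 𝟙 _ ⊗≫ (η[A] ▷ V.X ≫ V.act) ▷ W.X ≫ p := by monoidal
      _ = _ := by rw [one_act]; monoidal
  mul_smul := by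
    have h := (exists_quotient_act hp).choose_spec
    set m := (exists_quotient_act hp).choose
    change μ[A] ▷ _ ≫ m = (α_ _ _ _).hom ≫ A ◁ m ≫ m
    have : IsRegularEpi p := ⟨⟨⟨_, _, _, _, hp⟩⟩⟩
    rw [← cancel_epi ((A ⊗ A) ◁ p), whisker_exchange_assoc, h]
    calc _ = 𝟙 _ ⊗≫ (μ[A] ▷ V.X ≫ V.act) ▷ W.X ≫ p := by monoidal
      _ = 𝟙 _ ⊗≫ A ◁ V.act ▷ W.X ≫ ((α_ A V.X W.X).inv ≫ V.act ▷ W.X ≫ p) := by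
        rw [mul_act]; monoidal
      _ = 𝟙 _ ⊗≫ A ◁ V.act ▷ W.X ≫ A ◁ p ≫ m := by rw [← h]
      _ = 𝟙 _ ⊗≫ A ◁ ((α_ A V.X W.X).inv ≫ V.act ▷ W.X ≫ p) ≫ m := by monoidal
      _ = _ := by rw [← h]; monoidal

end Quotient

variable [HasCoequalizers C]
  [∀ Z : C, PreservesColimitsOfShape WalkingParallelPair (tensorLeft Z)]

/-- The relative tensor product `V ⊗_A W`. It is the coequalizer of the right action on `V` and the
left action on `W`, which is the quotient by `im (μ₁ - μ₂)` up to the braiding `R_{AX}`. -/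
noncomputable def relTensor (V W : Mod C A) : Mod C A where
  X := coequalizer (rightAct V ▷ W.X) ((α_ V.X A W.X).hom ≫ V.X ◁ W.act)
  mod := quotientModObj (coequalizerIsCoequalizer _ _)

/-- The projection `V ⊗ W ⟶ V ⊗_A W`. -/
noncomputable def relProj (V W : Mod C A) : V.X ⊗ W.X ⟶ (relTensor V W).X :=
  coequalizer.π _ _

theorem relProj_condition (V W : Mod C A) : rightAct V ▷ W.X ≫ relProj V W =
    ((α_ V.X A W.X).hom ≫ V.X ◁ W.act) ≫ relProj V W :=
  coequalizer.condition _ _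

/-- The defining cofork of `V ⊗_A W` is a colimit. -/
noncomputable def isColimitRelProj (V W : Mod C A) :
    IsColimit (Cofork.ofπ (relProj V W) (relProj_condition V W)) :=
  coequalizerIsCoequalizer _ _

theorem isBalanced_relProj (V W : Mod C A) : IsBalanced V W (relProj V W) := by
  rw [IsBalanced, relProj_condition, Category.assoc]

instance isRegularEpi_relProj (V W : Mod C A) : IsRegularEpi (relProj V W) :=
  ⟨⟨⟨_, _, _, _, isColimitRelProj V W⟩⟩⟩

theorem relProj_act (V W : Mod C A) : A ◁ relProj V W ≫ (relTensor V W).act =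
    (α_ A V.X W.X).inv ≫ V.act ▷ W.X ≫ relProj V W :=
  (exists_quotient_act (isColimitRelProj V W)).choose_spec

theorem relProj_rightAct (V W : Mod C A) : relProj V W ▷ A ≫ rightAct (relTensor V W) =
    (α_ V.X W.X A).hom ≫ V.X ◁ rightAct W ≫ relProj V W := by
  rw [← cancel_epi (β_ A (V.X ⊗ W.X)).hom, ← BraidedCategory.braiding_naturality_right_assoc,
    braiding_rightAct, relProj_act, BraidedCategory.braiding_tensor_right_hom]
  simp only [Category.assoc, Iso.inv_hom_id_assoc]
  rw [← whiskerLeft_comp_assoc, braiding_rightAct, ← isBalanced_relProj,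
    ← comp_whiskerRight_assoc, braiding_rightAct]

variable {V W : Mod C A}

theorem relTensor_hom_ext {Z : C} {f g : (relTensor V W).X ⟶ Z}
    (h : relProj V W ≫ f = relProj V W ≫ g) : f = g :=
  (cancel_epi (relProj V W)).1 h

/-- The morphism out of `V ⊗_A W` induced by a balanced morphism out of `V ⊗ W`. -/
noncomputable def relDesc {Z : C} (f : V.X ⊗ W.X ⟶ Z) (hf : IsBalanced V W f) :
    (relTensor V W).X ⟶ Z :=
  coequalizer.desc f (by rw [Category.assoc]; exact hf)

theorem relProj_relDesc {Z : C} (f : V.X ⊗ W.X ⟶ Z) (hf : IsBalanced V W f) :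
    relProj V W ≫ relDesc f hf = f :=
  coequalizer.π_desc _ _

variable (V W) in
theorem isRelTensor_relProj : IsRelTensor V W (relTensor V W) (relProj V W) where
  balanced := isBalanced_iff.1 (isBalanced_relProj V W)
  isColimit := ⟨Cofork.IsColimit.mk _ (fun s => relDesc s.π (isBalanced_iff.2 s.condition))
    (fun _ => relProj_relDesc _ _)
    (fun _ _ hm => relTensor_hom_ext (hm.trans (relProj_relDesc _ _).symm))⟩
  act := by rw [relProj_act, relAct₁, Category.assoc]

theorem isSemilinear_relTensor_iff {a : A ⟶ A} {Z : Mod C A} {f : (relTensor V W).X ⟶ Z.X} :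
    IsSemilinear a f ↔ V.act ▷ W.X ≫ relProj V W ≫ f =
      (α_ A V.X W.X).hom ≫ (a ⊗ₘ (relProj V W ≫ f)) ≫ Z.act := by
  rw [IsSemilinear, ← cancel_epi (A ◁ relProj V W), reassoc_of% relProj_act,
    whiskerLeft_comp_tensorHom_assoc, Iso.inv_comp_eq]

/-- The morphism `f ⊗_A g` induced by two morphisms semilinear along the same `a`. -/
noncomputable def relMap {a : A ⟶ A} {V' W' : Mod C A} {f : V.X ⟶ V'.X} {g : W.X ⟶ W'.X}
    (hf : IsSemilinear a f) (hg : IsSemilinear a g) : (relTensor V W).X ⟶ (relTensor V' W').X :=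
  relDesc ((f ⊗ₘ g) ≫ relProj V' W') ((isBalanced_relProj V' W').tensorHom_comp hf hg)

section Map

variable {a : A ⟶ A} {V' W' : Mod C A} {f : V.X ⟶ V'.X} {g : W.X ⟶ W'.X}
  (hf : IsSemilinear a f) (hg : IsSemilinear a g)

theorem relProj_relMap : relProj V W ≫ relMap hf hg = (f ⊗ₘ g) ≫ relProj V' W' :=
  relProj_relDesc _ _

theorem isSemilinear_relMap : IsSemilinear a (relMap hf hg) := by
  rw [isSemilinear_relTensor_iff, relProj_relMap, reassoc_of% hf.whiskerRight_act g,
    ← tensorHom_comp_whiskerLeft_assoc, relProj_act, associator_inv_naturality_assoc,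
    Iso.hom_inv_id_assoc]

end Map

end RelativeTensor

section Associativity

variable {C : Type u} [Category.{v} C] [MonoidalCategory C] [BraidedCategory C] {A : C} [MonObj A]
  [IsCommMonObj A] [HasCoequalizers C]
  [∀ Z : C, PreservesColimitsOfShape WalkingParallelPair (tensorLeft Z)]

theorem relTensor_hom_ext₃ {U V W : Mod C A} {Z : C} {f g : (relTensor (relTensor U V) W).X ⟶ Z}
    (h : relProj U V ▷ W.X ≫ relProj (relTensor U V) W ≫ f =
      relProj U V ▷ W.X ≫ relProj (relTensor U V) W ≫ g) : f = g :=
  relTensor_hom_ext ((cancel_epi (relProj U V ▷ W.X)).1 h)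

theorem relTensor_hom_ext₃' {U V W : Mod C A} {Z : C} {f g : (relTensor U (relTensor V W)).X ⟶ Z}
    (h : U.X ◁ relProj V W ≫ relProj U (relTensor V W) ≫ f =
      U.X ◁ relProj V W ≫ relProj U (relTensor V W) ≫ g) : f = g :=
  relTensor_hom_ext ((cancel_epi (U.X ◁ relProj V W)).1 h)

theorem isBalanced_of_whiskerRight_relProj_comp {U V W : Mod C A} {Z : C}
    {f : (relTensor U V).X ⊗ W.X ⟶ Z} {k : U.X ⊗ (relTensor V W).X ⟶ Z}
    (hf : relProj U V ▷ W.X ≫ f = (α_ U.X V.X W.X).hom ≫ U.X ◁ relProj V W ≫ k) :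
    IsBalanced (relTensor U V) W f := by
  rw [IsBalanced, ← cancel_epi (relProj U V ▷ A ▷ W.X), ← comp_whiskerRight_assoc,
    relProj_rightAct]
  calc _ = 𝟙 _ ⊗≫ U.X ◁ rightAct V ▷ W.X ⊗≫ (relProj U V ▷ W.X ≫ f) := by monoidal
    _ = 𝟙 _ ⊗≫ U.X ◁ (rightAct V ▷ W.X ≫ relProj V W) ≫ k := by rw [hf]; monoidal
    _ = 𝟙 _ ⊗≫ (U.X ⊗ V.X) ◁ W.act ≫ ((α_ U.X V.X W.X).hom ≫ U.X ◁ relProj V W ≫ k) := by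
        rw [isBalanced_relProj]; monoidal
    _ = 𝟙 _ ⊗≫ ((U.X ⊗ V.X) ◁ W.act ≫ relProj U V ▷ W.X) ≫ f := by rw [← hf]; monoidal
    _ = _ := by rw [whisker_exchange]; monoidal

theorem isBalanced_of_whiskerLeft_relProj_comp {U V W : Mod C A} {Z : C}
    {f : U.X ⊗ (relTensor V W).X ⟶ Z} {k : (relTensor U V).X ⊗ W.X ⟶ Z}
    (hf : U.X ◁ relProj V W ≫ f = (α_ U.X V.X W.X).inv ≫ relProj U V ▷ W.X ≫ k) :
    IsBalanced U (relTensor V W) f := by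
  rw [IsBalanced, ← cancel_epi ((U.X ⊗ A) ◁ relProj V W), whisker_exchange_assoc, hf]
  calc _ = 𝟙 _ ⊗≫ (rightAct U ▷ V.X ≫ relProj U V) ▷ W.X ≫ k := by monoidal
    _ = 𝟙 _ ⊗≫ (U.X ◁ V.act) ▷ W.X ⊗≫ ((α_ U.X V.X W.X).inv ≫ relProj U V ▷ W.X ≫ k) := by
        rw [isBalanced_relProj]; monoidal
    _ = 𝟙 _ ⊗≫ (U.X ◁ V.act) ▷ W.X ⊗≫ U.X ◁ relProj V W ≫ f := by rw [← hf]
    _ = 𝟙 _ ⊗≫ U.X ◁ ((α_ A V.X W.X).inv ≫ V.act ▷ W.X ≫ relProj V W) ≫ f := by monoidal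
    _ = _ := by rw [← relProj_act]; monoidal

theorem exists_relAssoc_hom (U V W : Mod C A) :
    ∃ f : (relTensor (relTensor U V) W).X ⟶ (relTensor U (relTensor V W)).X,
      relProj U V ▷ W.X ≫ relProj (relTensor U V) W ≫ f =
        (α_ U.X V.X W.X).hom ≫ U.X ◁ relProj V W ≫ relProj U (relTensor V W) := by
  suffices ∃ f, relProj U V ▷ W.X ≫ f =
      (α_ U.X V.X W.X).hom ≫ U.X ◁ relProj V W ≫ relProj U (relTensor V W) by
    obtain ⟨f, hf⟩ := this
    exact ⟨relDesc f (isBalanced_of_whiskerRight_relProj_comp hf), by rw [relProj_relDesc, hf]⟩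
  refine exists_whiskerRight_desc W.X (isColimitRelProj U V) _ ?_
  calc _ = 𝟙 _ ⊗≫ (rightAct U ▷ (V.X ⊗ W.X) ≫ U.X ◁ relProj V W) ≫
          relProj U (relTensor V W) := by monoidal
    _ = 𝟙 _ ⊗≫ (U.X ⊗ A) ◁ relProj V W ≫
          (rightAct U ▷ (relTensor V W).X ≫ relProj U (relTensor V W)) := by
        rw [← whisker_exchange]; monoidal
    _ = 𝟙 _ ⊗≫ U.X ◁ (A ◁ relProj V W ≫ (relTensor V W).act) ≫ relProj U (relTensor V W) := by
        rw [isBalanced_relProj]; monoidal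
    _ = _ := by rw [relProj_act]; monoidal

theorem exists_relAssoc_inv (U V W : Mod C A) :
    ∃ f : (relTensor U (relTensor V W)).X ⟶ (relTensor (relTensor U V) W).X,
      U.X ◁ relProj V W ≫ relProj U (relTensor V W) ≫ f =
        (α_ U.X V.X W.X).inv ≫ relProj U V ▷ W.X ≫ relProj (relTensor U V) W := by
  suffices ∃ f, U.X ◁ relProj V W ≫ f =
      (α_ U.X V.X W.X).inv ≫ relProj U V ▷ W.X ≫ relProj (relTensor U V) W by
    obtain ⟨f, hf⟩ := this
    exact ⟨relDesc f (isBalanced_of_whiskerLeft_relProj_comp hf), by rw [relProj_relDesc, hf]⟩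
  refine exists_whiskerLeft_desc U.X (isColimitRelProj V W) _ ?_
  calc _ = 𝟙 _ ⊗≫ ((α_ U.X V.X A).hom ≫ U.X ◁ rightAct V ≫ relProj U V) ▷ W.X ≫
          relProj (relTensor U V) W := by monoidal
    _ = 𝟙 _ ⊗≫ relProj U V ▷ A ▷ W.X ≫
          (rightAct (relTensor U V) ▷ W.X ≫ relProj (relTensor U V) W) := by
        rw [← relProj_rightAct]; monoidal
    _ = 𝟙 _ ⊗≫ (relProj U V ▷ (A ⊗ W.X) ≫ (relTensor U V).X ◁ W.act) ≫
          relProj (relTensor U V) W := by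
        rw [isBalanced_relProj]; monoidal
    _ = _ := by rw [← whisker_exchange]; monoidal

/-- The associativity isomorphism of `⊗_A`, induced by that of `C`. -/
noncomputable def relAssoc (U V W : Mod C A) :
    (relTensor (relTensor U V) W).X ≅ (relTensor U (relTensor V W)).X where
  hom := (exists_relAssoc_hom U V W).choose
  inv := (exists_relAssoc_inv U V W).choose
  hom_inv_id := relTensor_hom_ext₃ (by
    rw [reassoc_of% (exists_relAssoc_hom U V W).choose_spec,
      (exists_relAssoc_inv U V W).choose_spec, Iso.hom_inv_id_assoc, Category.comp_id])
  inv_hom_id := relTensor_hom_ext₃' (by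
    rw [reassoc_of% (exists_relAssoc_inv U V W).choose_spec,
      (exists_relAssoc_hom U V W).choose_spec, Iso.inv_hom_id_assoc, Category.comp_id])

theorem relProj_relAssoc_hom (U V W : Mod C A) :
    relProj U V ▷ W.X ≫ relProj (relTensor U V) W ≫ (relAssoc U V W).hom =
      (α_ U.X V.X W.X).hom ≫ U.X ◁ relProj V W ≫ relProj U (relTensor V W) :=
  (exists_relAssoc_hom U V W).choose_spec

theorem isSemilinear_relAssoc_hom (U V W : Mod C A) :
    IsSemilinear (𝟙 A) (relAssoc U V W).hom := by
  rw [isSemilinear_relTensor_iff, id_tensorHom, ← cancel_epi ((A ◁ relProj U V) ▷ W.X),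
    ← comp_whiskerRight_assoc, relProj_act]
  set p₁ := relProj (relTensor U V) W ≫ (relAssoc U V W).hom
  have hp₁ : relProj U V ▷ W.X ≫ p₁ =
      (α_ U.X V.X W.X).hom ≫ U.X ◁ relProj V W ≫ relProj U (relTensor V W) :=
    relProj_relAssoc_hom U V W
  calc _ = 𝟙 _ ⊗≫ U.act ▷ V.X ▷ W.X ≫ (relProj U V ▷ W.X ≫ p₁) := by monoidal
    _ = 𝟙 _ ⊗≫ (U.act ▷ (V.X ⊗ W.X) ≫ U.X ◁ relProj V W) ≫ relProj U (relTensor V W) := by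
        rw [hp₁]; monoidal
    _ = 𝟙 _ ⊗≫ (A ⊗ U.X) ◁ relProj V W ⊗≫
          ((α_ A U.X _).inv ≫ U.act ▷ (relTensor V W).X ≫ relProj U (relTensor V W)) := by
        rw [← whisker_exchange]; monoidal
    _ = 𝟙 _ ⊗≫ A ◁ ((α_ U.X V.X W.X).hom ≫ U.X ◁ relProj V W ≫ relProj U (relTensor V W)) ≫
          (relTensor U (relTensor V W)).act := by
        rw [← relProj_act]; monoidal
    _ = _ := by rw [← hp₁]; monoidal

theorem relMap_relAssoc_hom {a : A ⟶ A} {U U' V V' W W' : Mod C A} {f : U.X ⟶ U'.X}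
    {g : V.X ⟶ V'.X} {h : W.X ⟶ W'.X} (hf : IsSemilinear a f) (hg : IsSemilinear a g)
    (hh : IsSemilinear a h) :
    relMap (isSemilinear_relMap hf hg) hh ≫ (relAssoc U' V' W').hom =
      (relAssoc U V W).hom ≫ relMap hf (isSemilinear_relMap hg hh) := by
  apply relTensor_hom_ext₃
  rw [reassoc_of% relProj_relMap, whiskerRight_comp_tensorHom_assoc, relProj_relMap,
    ← tensorHom_comp_whiskerRight_assoc, relProj_relAssoc_hom, reassoc_of% relProj_relAssoc_hom,
    relProj_relMap, whiskerLeft_comp_tensorHom_assoc, relProj_relMap,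
    ← tensorHom_comp_whiskerLeft_assoc, associator_naturality_assoc]

theorem relAssoc_pentagon (U V W X : Mod C A) :
    relMap (isSemilinear_relAssoc_hom U V W) (IsSemilinear.id X) ≫
        (relAssoc U (relTensor V W) X).hom ≫
          relMap (IsSemilinear.id U) (isSemilinear_relAssoc_hom V W X) =
      (relAssoc (relTensor U V) W X).hom ≫ (relAssoc U V (relTensor W X)).hom := by
  apply relTensor_hom_ext₃
  rw [← cancel_epi (relProj U V ▷ W.X ▷ X.X)]
  have hUVW : relProj U V ▷ W.X ▷ X.X ≫ relProj (relTensor U V) W ▷ X.X ≫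
      (relAssoc U V W).hom ▷ X.X = (α_ U.X V.X W.X).hom ▷ X.X ≫ (U.X ◁ relProj V W) ▷ X.X ≫
        relProj U (relTensor V W) ▷ X.X := by
    simp only [← comp_whiskerRight, relProj_relAssoc_hom]
  have hVWX : U.X ◁ relProj V W ▷ X.X ≫ U.X ◁ relProj (relTensor V W) X ≫
      U.X ◁ (relAssoc V W X).hom = U.X ◁ (α_ V.X W.X X.X).hom ≫ U.X ◁ V.X ◁ relProj W X ≫
        U.X ◁ relProj V (relTensor W X) := by
    simp only [← whiskerLeft_comp, relProj_relAssoc_hom]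
  rw [reassoc_of% relProj_relMap, tensorHom_id, reassoc_of% hUVW,
    reassoc_of% relProj_relAssoc_hom, relProj_relMap, id_tensorHom,
    associator_naturality_middle_assoc, reassoc_of% hVWX,
    reassoc_of% (relProj_relAssoc_hom (relTensor U V) W X), associator_naturality_left_assoc,
    ← whisker_exchange_assoc, relProj_relAssoc_hom, associator_naturality_right_assoc]
  simp

end Associativity

section Unitality

variable {C : Type u} [Category.{v} C] [MonoidalCategory C] [BraidedCategory C] {A : C} [MonObj A]

theorem isBalanced_act (V : Mod C A) [IsCommMonObj A] : IsBalanced (regularMod A) V V.act := by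
  rw [IsBalanced, regularMod_rightAct]
  exact mul_act V

theorem isBalanced_rightAct (V : Mod C A) [IsCommMonObj A] :
    IsBalanced V (regularMod A) (rightAct V) := by
  rw [IsBalanced, regularMod_act, mul_rightAct, Iso.hom_inv_id_assoc]

variable [IsCommMonObj A] [HasCoequalizers C]
  [∀ Z : C, PreservesColimitsOfShape WalkingParallelPair (tensorLeft Z)]

/-- The unit isomorphism `A ⊗_A V ≅ V`, induced by the action of `A`. -/
noncomputable def relLeftUnitor (V : Mod C A) : (relTensor (regularMod A) V).X ≅ V.X where
  hom := relDesc V.act (isBalanced_act V)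
  inv := (λ_ V.X).inv ≫ η[A] ▷ V.X ≫ relProj (regularMod A) V
  hom_inv_id := by
    have hbal := isBalanced_relProj (regularMod A) V
    rw [IsBalanced, regularMod_rightAct] at hbal
    apply relTensor_hom_ext
    rw [reassoc_of% relProj_relDesc, leftUnitor_inv_naturality_assoc, whisker_exchange_assoc]
    calc _ = 𝟙 _ ⊗≫ η[A] ▷ (A ⊗ V.X) ⊗≫
          ((α_ A A V.X).hom ≫ A ◁ V.act ≫ relProj (regularMod A) V) := by monoidal
      _ = 𝟙 _ ⊗≫ (η[A] ▷ A ≫ μ[A]) ▷ V.X ≫ relProj (regularMod A) V := by rw [← hbal]; monoidal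
      _ = _ := by rw [MonObj.one_mul]; monoidal
  inv_hom_id := by
    rw [Category.assoc, Category.assoc, relProj_relDesc, one_act, Iso.inv_hom_id]

theorem relProj_relLeftUnitor_hom (V : Mod C A) :
    relProj (regularMod A) V ≫ (relLeftUnitor V).hom = V.act :=
  relProj_relDesc _ (isBalanced_act V)

/-- The unit isomorphism `V ⊗_A A ≅ V`, induced by the right action of `A`. -/
noncomputable def relRightUnitor (V : Mod C A) : (relTensor V (regularMod A)).X ≅ V.X where
  hom := relDesc (rightAct V) (isBalanced_rightAct V)
  inv := (ρ_ V.X).inv ≫ V.X ◁ η[A] ≫ relProj V (regularMod A)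
  hom_inv_id := by
    have hbal := isBalanced_relProj V (regularMod A)
    rw [IsBalanced, regularMod_act] at hbal
    apply relTensor_hom_ext
    rw [reassoc_of% relProj_relDesc, rightUnitor_inv_naturality_assoc, ← whisker_exchange_assoc,
      hbal]
    calc _ = 𝟙 _ ⊗≫ V.X ◁ (A ◁ η[A] ≫ μ[A]) ≫ relProj V (regularMod A) := by monoidal
      _ = _ := by rw [MonObj.mul_one]; monoidal
  inv_hom_id := by
    rw [Category.assoc, Category.assoc, relProj_relDesc, one_rightAct, Iso.inv_hom_id]

theorem relProj_relRightUnitor_hom (V : Mod C A) :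
    relProj V (regularMod A) ≫ (relRightUnitor V).hom = rightAct V :=
  relProj_relDesc _ (isBalanced_rightAct V)

theorem isSemilinear_relLeftUnitor_hom (V : Mod C A) :
    IsSemilinear (𝟙 A) (relLeftUnitor V).hom := by
  rw [isSemilinear_relTensor_iff, relProj_relLeftUnitor_hom, id_tensorHom]
  exact mul_act V

theorem isSemilinear_relRightUnitor_hom (V : Mod C A) :
    IsSemilinear (𝟙 A) (relRightUnitor V).hom := by
  rw [isSemilinear_relTensor_iff, relProj_relRightUnitor_hom, id_tensorHom]
  exact act_rightAct V

theorem relMap_relLeftUnitor_hom {a : A ⟶ A} [IsMonHom a] {V W : Mod C A} {f : V.X ⟶ W.X}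
    (hf : IsSemilinear a f) :
    relMap (IsSemilinear.regular a) hf ≫ (relLeftUnitor W).hom = (relLeftUnitor V).hom ≫ f := by
  apply relTensor_hom_ext
  rw [reassoc_of% relProj_relMap, relProj_relLeftUnitor_hom,
    reassoc_of% relProj_relLeftUnitor_hom V, hf]

theorem relMap_relRightUnitor_hom {a : A ⟶ A} [IsMonHom a] {V W : Mod C A} {f : V.X ⟶ W.X}
    (hf : IsSemilinear a f) :
    relMap hf (IsSemilinear.regular a) ≫ (relRightUnitor W).hom = (relRightUnitor V).hom ≫ f := by
  apply relTensor_hom_ext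
  rw [reassoc_of% relProj_relMap, relProj_relRightUnitor_hom,
    reassoc_of% relProj_relRightUnitor_hom V, hf.rightAct]

theorem relAssoc_triangle (V W : Mod C A) :
    (relAssoc V (regularMod A) W).hom ≫
        relMap (IsSemilinear.id V) (isSemilinear_relLeftUnitor_hom W) =
      relMap (isSemilinear_relRightUnitor_hom V) (IsSemilinear.id W) := by
  apply relTensor_hom_ext₃
  rw [reassoc_of% relProj_relAssoc_hom, relProj_relMap, relProj_relMap, id_tensorHom,
    tensorHom_id, ← whiskerLeft_comp_assoc, relProj_relLeftUnitor_hom,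
    ← comp_whiskerRight_assoc, relProj_relRightUnitor_hom, isBalanced_relProj]

end Unitality

namespace EquivMod

section Morphisms

variable {C : Type u} [Category.{v} C] [MonoidalCategory C] {G : Type w} [Group G] {A : C}
  [MonObj A] {π : AlgAction G A}

theorem isSemilinear_ρ (V : EquivMod π) (g : G) :
    IsSemilinear (V := V.M) (W := V.M) (π.π g) (V.ρ g) :=
  V.compat g

theorem ρ_one (V : EquivMod π) : V.ρ 1 = 𝟙 V.X :=
  V.φ.map_one

theorem ρ_mul (V : EquivMod π) (g h : G) : V.ρ (g * h) = V.ρ h ≫ V.ρ g :=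
  V.φ.map_mul g h

theorem isSemilinear_toC {V W : EquivMod π} (f : V ⟶ W) :
    IsSemilinear (V := V.M) (W := W.M) (𝟙 A) (toC f) :=
  IsSemilinear.of_hom f.hom

theorem act_toC {V W : EquivMod π} (f : V ⟶ W) : V.M.act ≫ toC f = A ◁ toC f ≫ W.M.act :=
  IsSemilinear.id_iff.1 (isSemilinear_toC f)

theorem ρ_toC {V W : EquivMod π} (f : V ⟶ W) (g : G) : V.ρ g ≫ toC f = toC f ≫ W.ρ g :=
  f.comm g

/-- The morphism of `𝒟` given by an `A`-linear and `G`-equivariant morphism of `C`. -/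
def homMk {V W : EquivMod π} (f : V.X ⟶ W.X)
    (hf : IsSemilinear (V := V.M) (W := W.M) (𝟙 A) f) (hG : ∀ g, V.ρ g ≫ f = f ≫ W.ρ g) :
    V ⟶ W :=
  ⟨Mod.Hom.mk' f (IsSemilinear.id_iff.1 hf), hG⟩

/-- The isomorphism of `𝒟` given by an `A`-linear and `G`-equivariant isomorphism of `C`. -/
def isoMk {V W : EquivMod π} (e : V.X ≅ W.X)
    (he : IsSemilinear (V := V.M) (W := W.M) (𝟙 A) e.hom)
    (hG : ∀ g, V.ρ g ≫ e.hom = e.hom ≫ W.ρ g) : V ≅ W where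
  hom := homMk e.hom he hG
  inv := homMk e.inv
    (by rw [IsSemilinear.id_iff] at he ⊢
        rw [Iso.comp_inv_eq, Category.assoc, he, ← whiskerLeft_comp_assoc, Iso.inv_hom_id,
          whiskerLeft_id, Category.id_comp])
    (fun g => by rw [Iso.eq_inv_comp, ← reassoc_of% hG, Iso.hom_inv_id, Category.comp_id])
  hom_inv_id := hom_ext' e.hom_inv_id
  inv_hom_id := hom_ext' e.inv_hom_id

end Morphisms

section Monoidal

variable {C : Type u} [Category.{v} C] [MonoidalCategory C] [BraidedCategory C] {G : Type w}
  [Group G] {A : C} [MonObj A] {π : AlgAction G A} [IsCommMonObj A] [HasCoequalizers C]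
  [∀ Z : C, PreservesColimitsOfShape WalkingParallelPair (tensorLeft Z)]

/-- The tensor product `(V ⊗_A W, φ_V ⊗ φ_W)`. -/
noncomputable abbrev tensor (V W : EquivMod π) : EquivMod π where
  M := relTensor V.M W.M
  φ :=
    { toFun g := relMap (V.isSemilinear_ρ g) (W.isSemilinear_ρ g)
      map_one' := relTensor_hom_ext (by
        change _ = relProj V.M W.M ≫ 𝟙 _
        rw [relProj_relMap, ρ_one, ρ_one, id_tensorHom_id, Category.id_comp, Category.comp_id])
      map_mul' g h := relTensor_hom_ext (by
        change _ = relProj V.M W.M ≫ relMap _ _ ≫ relMap _ _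
        rw [relProj_relMap, reassoc_of% relProj_relMap, relProj_relMap, ρ_mul, ρ_mul,
          ← tensorHom_comp_tensorHom_assoc]) }
  compat g := isSemilinear_relMap (V.isSemilinear_ρ g) (W.isSemilinear_ρ g)

/-- The tensor product of morphisms of `𝒟`. -/
noncomputable def tensorMap {V V' W W' : EquivMod π} (f : V ⟶ V') (g : W ⟶ W') :
    tensor V W ⟶ tensor V' W' :=
  homMk (relMap (isSemilinear_toC f) (isSemilinear_toC g)) (isSemilinear_relMap _ _)
    (fun x => relTensor_hom_ext (by
      change _ ≫ relMap (V.isSemilinear_ρ x) (W.isSemilinear_ρ x) ≫ _ =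
        _ ≫ _ ≫ relMap (V'.isSemilinear_ρ x) (W'.isSemilinear_ρ x)
      rw [reassoc_of% relProj_relMap, relProj_relMap, reassoc_of% relProj_relMap,
        relProj_relMap, tensorHom_comp_tensorHom_assoc, tensorHom_comp_tensorHom_assoc, ρ_toC,
        ρ_toC]))

noncomputable instance : MonoidalCategoryStruct (EquivMod π) where
  tensorObj := tensor
  tensorHom := tensorMap
  whiskerLeft V _ _ f := tensorMap (𝟙 V) f
  whiskerRight f W := tensorMap f (𝟙 W)
  tensorUnit :=
    { M := regularMod A
      φ := π.π
      compat := (algObj π).compat }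
  associator U V W := isoMk (relAssoc U.M V.M W.M) (isSemilinear_relAssoc_hom _ _ _) fun g =>
    relMap_relAssoc_hom (U.isSemilinear_ρ g) (V.isSemilinear_ρ g) (W.isSemilinear_ρ g)
  leftUnitor V := isoMk (relLeftUnitor V.M) (isSemilinear_relLeftUnitor_hom _) fun g =>
    have := π.isMonHom g
    relMap_relLeftUnitor_hom (V.isSemilinear_ρ g)
  rightUnitor V := isoMk (relRightUnitor V.M) (isSemilinear_relRightUnitor_hom _) fun g =>
    have := π.isMonHom g
    relMap_relRightUnitor_hom (V.isSemilinear_ρ g)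

/-- The projection `V ⊗ W ⟶ V ⊗_A W` of `C`. -/
noncomputable def proj (V W : EquivMod π) : V.X ⊗ W.X ⟶ (V ⊗ W).X :=
  relProj V.M W.M

instance (V W : EquivMod π) : IsRegularEpi (proj V W) :=
  isRegularEpi_relProj V.M W.M

theorem tensorObj_hom_ext {V W Z : EquivMod π} {f g : V ⊗ W ⟶ Z}
    (h : proj V W ≫ toC f = proj V W ≫ toC g) : f = g :=
  hom_ext' ((cancel_epi (proj V W)).1 h)

@[simp]
theorem proj_tensorHom {V V' W W' : EquivMod π} (f : V ⟶ V') (g : W ⟶ W') :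
    proj V W ≫ toC (f ⊗ₘ g) = (toC f ⊗ₘ toC g) ≫ proj V' W' :=
  relProj_relMap (isSemilinear_toC f) (isSemilinear_toC g)

noncomputable instance : MonoidalCategory (EquivMod π) :=
  MonoidalCategory.ofTensorHom
    (id_tensorHom_id := fun V W => tensorObj_hom_ext (by
      rw [proj_tensorHom, toC_id, toC_id, id_tensorHom_id, toC_id, Category.id_comp,
        Category.comp_id]))
    (id_tensorHom := fun _ _ _ _ => rfl)
    (tensorHom_id := fun _ _ => rfl)
    (tensorHom_comp_tensorHom := fun f g f' g' => tensorObj_hom_ext (by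
      rw [toC_comp, reassoc_of% proj_tensorHom, proj_tensorHom, proj_tensorHom,
        tensorHom_comp_tensorHom_assoc, toC_comp, toC_comp]))
    (associator_naturality := fun f g h => hom_ext' (relMap_relAssoc_hom (isSemilinear_toC f)
      (isSemilinear_toC g) (isSemilinear_toC h)))
    (leftUnitor_naturality := fun f => hom_ext' (relMap_relLeftUnitor_hom (isSemilinear_toC f)))
    (rightUnitor_naturality := fun f => hom_ext' (relMap_relRightUnitor_hom (isSemilinear_toC f)))
    (pentagon := fun U V W X => hom_ext' (relAssoc_pentagon U.M V.M W.M X.M))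
    (triangle := fun V W => hom_ext' (relAssoc_triangle V.M W.M))

theorem tensorObj_hom_ext₃ {U V W Z : EquivMod π} {f g : (U ⊗ V) ⊗ W ⟶ Z}
    (h : proj U V ▷ W.X ≫ proj (U ⊗ V) W ≫ toC f = proj U V ▷ W.X ≫ proj (U ⊗ V) W ≫ toC g) :
    f = g :=
  tensorObj_hom_ext ((cancel_epi (proj U V ▷ W.X)).1 h)

theorem proj_ρ (V W : EquivMod π) (g : G) :
    proj V W ≫ (V ⊗ W).ρ g = (V.ρ g ⊗ₘ W.ρ g) ≫ proj V W :=
  relProj_relMap (V.isSemilinear_ρ g) (W.isSemilinear_ρ g)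

theorem proj_act (V W : EquivMod π) : A ◁ proj V W ≫ (V ⊗ W).M.act =
    (α_ A V.X W.X).inv ≫ V.M.act ▷ W.X ≫ proj V W :=
  relProj_act V.M W.M

theorem proj_rightAct (V W : EquivMod π) : proj V W ▷ A ≫ rightAct (V ⊗ W).M =
    (α_ V.X W.X A).hom ≫ V.X ◁ rightAct W.M ≫ proj V W :=
  relProj_rightAct V.M W.M

@[simp]
theorem proj_whiskerLeft (V : EquivMod π) {W W' : EquivMod π} (g : W ⟶ W') :
    proj V W ≫ toC (V ◁ g) = V.X ◁ toC g ≫ proj V W' := by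
  rw [← id_tensorHom, proj_tensorHom, toC_id, id_tensorHom]

@[simp]
theorem proj_whiskerRight {V V' : EquivMod π} (f : V ⟶ V') (W : EquivMod π) :
    proj V W ≫ toC (f ▷ W) = toC f ▷ W.X ≫ proj V' W := by
  rw [← tensorHom_id, proj_tensorHom, toC_id, tensorHom_id]

@[simp]
theorem proj_associator_hom (U V W : EquivMod π) :
    proj U V ▷ W.X ≫ proj (U ⊗ V) W ≫ toC (α_ U V W).hom =
      (α_ U.X V.X W.X).hom ≫ U.X ◁ proj V W ≫ proj U (V ⊗ W) :=
  relProj_relAssoc_hom U.M V.M W.M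

theorem proj_associator_inv (U V W : EquivMod π) :
    U.X ◁ proj V W ≫ proj U (V ⊗ W) ≫ toC (α_ U V W).inv =
      (α_ U.X V.X W.X).inv ≫ proj U V ▷ W.X ≫ proj (U ⊗ V) W := by
  rw [Iso.eq_inv_comp, ← reassoc_of% proj_associator_hom U V W, ← toC_comp, Iso.hom_inv_id,
    toC_id, Category.comp_id]

@[simp]
theorem proj_leftUnitor_hom (V : EquivMod π) :
    proj (𝟙_ (EquivMod π)) V ≫ toC (λ_ V).hom = V.M.act :=
  relProj_relLeftUnitor_hom V.M

@[simp]
theorem proj_rightUnitor_hom (V : EquivMod π) :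
    proj V (𝟙_ (EquivMod π)) ≫ toC (ρ_ V).hom = rightAct V.M :=
  relProj_relRightUnitor_hom V.M

theorem toC_leftUnitor_inv (V : EquivMod π) : toC (λ_ V).inv =
    (λ_ V.X).inv ≫ η[A] ▷ V.X ≫ proj (𝟙_ (EquivMod π)) V :=
  rfl

theorem toC_rightUnitor_inv (V : EquivMod π) : toC (ρ_ V).inv =
    (ρ_ V.X).inv ≫ V.X ◁ η[A] ≫ proj V (𝟙_ (EquivMod π)) :=
  rfl

theorem unit_hom_ext {V : EquivMod π} {f g : 𝟙_ (EquivMod π) ⟶ V}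
    (h : η[A] ≫ toC f = η[A] ≫ toC g) : f = g :=
  hom_ext' ((isSemilinear_toC f).ext_one (isSemilinear_toC g) h)

/-- The unit object of `𝒟` is `(A, π)`. -/
def unitIso : 𝟙_ (EquivMod π) ≅ algObj π :=
  Iso.refl (algObj π)

theorem isNaturalTensor_proj : IsNaturalTensor (π := π) proj unitIso where
  tensor V W := isRelTensor_relProj V.M W.M
  action := proj_ρ
  hom := proj_tensorHom
  associator := proj_associator_hom
  leftUnitor V := by
    rw [proj_leftUnitor_hom]
    exact (congrArg (· ▷ V.X ≫ V.M.act) (Category.comp_id η[A])).trans (one_act V.M)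
  rightUnitor V := by
    rw [proj_rightUnitor_hom]
    exact (congrArg (V.X ◁ · ≫ rightAct V.M) (Category.comp_id η[A])).trans (one_rightAct V.M)

end Monoidal

end EquivMod

namespace EquivMod

section Forget

variable {C : Type u} [Category.{v} C] [MonoidalCategory C] {G : Type w} [Group G] {A : C}
  [MonObj A] {π : AlgAction G A}

variable (π) in
/-- The forgetful functor from `𝒟` to `C`. -/
def forgetC : EquivMod π ⥤ C where
  obj V := V.X
  map f := toC f

instance : (forgetC π).Faithful := ⟨hom_ext'⟩

instance : (forgetC π).ReflectsIsomorphisms where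
  reflects f (_ : IsIso (toC f)) :=
    (isoMk (asIso (toC f)) (isSemilinear_toC f) (ρ_toC f)).isIso_hom

section OfJointlyMono

variable {J : Type*} {V : J → EquivMod π} {K : C} (k : ∀ i, K ⟶ (V i).X)
  (hk : ∀ {Z : C} {f g : Z ⟶ K}, (∀ i, f ≫ k i = g ≫ k i) → f = g)
  (m : A ⊗ K ⟶ K) (hm : ∀ i, m ≫ k i = A ◁ k i ≫ (V i).M.act)
  (r : G → (K ⟶ K)) (hr : ∀ g i, r g ≫ k i = k i ≫ (V i).ρ g)

/-- An object `K` of `C` with a jointly monic family of maps `k i` to objects of `𝒟`, and with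
operators compatible with those along the `k i`, as an object of `𝒟`: the identities can be checked
after composition with the `k i`. -/
abbrev ofJointlyMono : EquivMod π where
  M :=
    { X := K
      mod :=
        { smul := m
          one_smul := hk fun i => by
            change (η[A] ▷ K ≫ m) ≫ _ = (λ_ K).hom ≫ _
            rw [Category.assoc, hm, ← whisker_exchange_assoc, one_act, leftUnitor_naturality]
          mul_smul := hk fun i => by
            change (μ[A] ▷ K ≫ m) ≫ _ = ((α_ A A K).hom ≫ A ◁ m ≫ m) ≫ _
            rw [Category.assoc, hm, ← whisker_exchange_assoc, mul_act,
              associator_naturality_right_assoc, Category.assoc, Category.assoc, hm,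
              ← whiskerLeft_comp_assoc, ← whiskerLeft_comp_assoc, hm] } }
  φ :=
    { toFun := r
      map_one' := hk fun i => by
        rw [hr, ρ_one, Category.comp_id, End.one_def, Category.id_comp]
      map_mul' g h := hk fun i => by
        rw [hr, ρ_mul, End.mul_def, Category.assoc, hr, reassoc_of% hr] }
  compat g := hk fun i => by
    change (m ≫ r g) ≫ _ = ((π.π g ⊗ₘ r g) ≫ m) ≫ _
    rw [Category.assoc, Category.assoc, hr, reassoc_of% hm, hm, (V i).isSemilinear_ρ g,
      tensorHom_comp_whiskerLeft_assoc, hr, whiskerLeft_comp_tensorHom_assoc]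

/-- A morphism of `C` between objects of `𝒟` which lifts morphisms of `𝒟` along a jointly monic
family of morphisms of `𝒟`. -/
def homOfJointlyMono {W K : EquivMod π} (k : ∀ i, K ⟶ V i)
    (hk : ∀ {Z : C} {f g : Z ⟶ K.X}, (∀ i, f ≫ toC (k i) = g ≫ toC (k i)) → f = g)
    (l : W.X ⟶ K.X) (f : ∀ i, W ⟶ V i) (hl : ∀ i, l ≫ toC (k i) = toC (f i)) : W ⟶ K :=
  homMk l
    (IsSemilinear.id_iff.2 <| hk fun i => by
      rw [Category.assoc, Category.assoc, hl, act_toC, act_toC, ← whiskerLeft_comp_assoc, hl])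
    fun g => hk fun i => by
      rw [Category.assoc, Category.assoc, hl, ρ_toC, ρ_toC, reassoc_of% hl]

end OfJointlyMono

section OfJointlyEpi

variable {J : Type*} {V : J → EquivMod π} {Q : C} (q : ∀ i, (V i).X ⟶ Q)

theorem jointlyEpi_of_whiskerLeft_unit
    (hq : ∀ {Z : C} {f g : 𝟙_ C ⊗ Q ⟶ Z}, (∀ i, 𝟙_ C ◁ q i ≫ f = 𝟙_ C ◁ q i ≫ g) → f = g)
    {Z : C} {f g : Q ⟶ Z} (h : ∀ i, q i ≫ f = q i ≫ g) : f = g := by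
  rw [← cancel_epi (λ_ Q).hom]
  exact hq fun i => by
    rw [leftUnitor_naturality_assoc, leftUnitor_naturality_assoc, h]

variable (hq : ∀ {Z Z' : C} {f g : Z ⊗ Q ⟶ Z'}, (∀ i, Z ◁ q i ≫ f = Z ◁ q i ≫ g) → f = g)
  (m : A ⊗ Q ⟶ Q) (hm : ∀ i, A ◁ q i ≫ m = (V i).M.act ≫ q i)
  (r : G → (Q ⟶ Q)) (hr : ∀ g i, q i ≫ r g = (V i).ρ g ≫ q i)

/-- An object `Q` of `C` with a family of maps `q i` from objects of `𝒟` which is jointly epic, also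
after tensoring, and with operators compatible with those along the `q i`, as an object of `𝒟`. -/
abbrev ofJointlyEpi : EquivMod π where
  M :=
    { X := Q
      mod :=
        { smul := m
          one_smul := hq fun i => by
            change 𝟙_ C ◁ q i ≫ η[A] ▷ Q ≫ m = 𝟙_ C ◁ q i ≫ (λ_ Q).hom
            rw [whisker_exchange_assoc, hm, reassoc_of% one_act, leftUnitor_naturality]
          mul_smul := hq fun i => by
            change (A ⊗ A) ◁ q i ≫ μ[A] ▷ Q ≫ m =
              (A ⊗ A) ◁ q i ≫ (α_ A A Q).hom ≫ A ◁ m ≫ m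
            rw [whisker_exchange_assoc, hm, reassoc_of% mul_act,
              associator_naturality_right_assoc, ← whiskerLeft_comp_assoc, hm,
              whiskerLeft_comp_assoc, hm] } }
  φ :=
    { toFun := r
      map_one' := jointlyEpi_of_whiskerLeft_unit q hq fun i => by
        rw [hr, ρ_one, Category.id_comp, End.one_def, Category.comp_id]
      map_mul' g h := jointlyEpi_of_whiskerLeft_unit q hq fun i => by
        rw [hr, ρ_mul, End.mul_def, reassoc_of% hr, hr, Category.assoc] }
  compat g := hq fun i => by
    change _ ≫ m ≫ r g = _ ≫ (π.π g ⊗ₘ r g) ≫ m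
    rw [reassoc_of% hm, hr, reassoc_of% (V i).isSemilinear_ρ g, whiskerLeft_comp_tensorHom_assoc,
      hr, ← tensorHom_comp_whiskerLeft_assoc, hm]

/-- A morphism of `C` between objects of `𝒟` which descends morphisms of `𝒟` along a family of
morphisms of `𝒟` that is jointly epic, also after tensoring. -/
def homOfJointlyEpi {Q W : EquivMod π} (q : ∀ i, V i ⟶ Q)
    (hq : ∀ {Z Z' : C} {f g : Z ⊗ Q.X ⟶ Z'},
      (∀ i, Z ◁ toC (q i) ≫ f = Z ◁ toC (q i) ≫ g) → f = g)
    (l : Q.X ⟶ W.X) (f : ∀ i, V i ⟶ W) (hl : ∀ i, toC (q i) ≫ l = toC (f i)) : Q ⟶ W :=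
  homMk l
    (IsSemilinear.id_iff.2 <| hq fun i => by
      rw [← reassoc_of% act_toC, hl, act_toC, ← whiskerLeft_comp_assoc, hl])
    fun g => jointlyEpi_of_whiskerLeft_unit (toC <| q ·) hq fun i => by
      rw [← reassoc_of% ρ_toC, hl, ρ_toC, reassoc_of% hl]

end OfJointlyEpi

variable {J : Type*} [Category* J] {F : J ⥤ EquivMod π}

section Limits

variable {c : Cone (F ⋙ forgetC π)}

/-- `c.π.app j`, typed so that the operators on `F.obj j` can be composed with it. -/
def coneProj (c : Cone (F ⋙ forgetC π)) (j : J) : c.pt ⟶ (F.obj j).X :=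
  c.π.app j

theorem coneProj_map (c : Cone (F ⋙ forgetC π)) {i j : J} (f : i ⟶ j) :
    coneProj c i ≫ toC (F.map f) = coneProj c j :=
  c.w f

theorem coneProj_hom_ext (hc : IsLimit c) {Z : C} {f g : Z ⟶ c.pt}
    (h : ∀ j, f ≫ coneProj c j = g ≫ coneProj c j) : f = g :=
  hc.hom_ext h

theorem exists_coneProj_lift (hc : IsLimit c) {Z : C} (k : ∀ j, Z ⟶ (F.obj j).X)
    (hk : ∀ {i j : J} (f : i ⟶ j), k i ≫ toC (F.map f) = k j) :
    ∃ l : Z ⟶ c.pt, ∀ j, l ≫ coneProj c j = k j :=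
  ⟨hc.lift ⟨Z, { app := k, naturality _ _ f := (Category.id_comp _).trans (hk f).symm }⟩,
    hc.fac _⟩

theorem exists_limit_act (hc : IsLimit c) : ∃ m : A ⊗ c.pt ⟶ c.pt,
    ∀ j, m ≫ coneProj c j = A ◁ coneProj c j ≫ (F.obj j).M.act :=
  exists_coneProj_lift hc _ fun f => by
    rw [Category.assoc, act_toC, ← whiskerLeft_comp_assoc, coneProj_map]

theorem exists_limit_ρ (hc : IsLimit c) (g : G) : ∃ r : c.pt ⟶ c.pt,
    ∀ j, r ≫ coneProj c j = coneProj c j ≫ (F.obj j).ρ g :=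
  exists_coneProj_lift hc _ fun f => by
    rw [Category.assoc, ρ_toC, reassoc_of% coneProj_map]

theorem exists_isLimit_mapCone_forgetC (hc : IsLimit c) : ∃ c' : Cone F,
    Nonempty (IsLimit c') ∧ Nonempty (IsLimit ((forgetC π).mapCone c')) := by
  obtain ⟨m, hm⟩ := exists_limit_act hc
  choose r hr using exists_limit_ρ hc
  let K : EquivMod π := ofJointlyMono (V := F.obj) (coneProj c) (coneProj_hom_ext hc) m hm r hr
  let c' : Cone F :=
    { pt := K
      π :=
        { app j := homMk (V := K) (coneProj c j) (IsSemilinear.id_iff.2 (hm j)) fun g => hr g j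
          naturality _ _ f := hom_ext' (c.π.naturality f) } }
  exact ⟨c',
    ⟨{ lift s := homOfJointlyMono c'.π.app (coneProj_hom_ext hc)
          (hc.lift ((forgetC π).mapCone s)) s.π.app (hc.fac _)
       fac s j := hom_ext' (hc.fac _ j)
       uniq s l hl := hom_ext' <|
        hc.uniq ((forgetC π).mapCone s) (toC l) fun j => congrArg toC (hl j) }⟩,
    ⟨hc⟩⟩

instance [HasLimitsOfShape J C] : HasLimitsOfShape J (EquivMod π) where
  has_limit F :=
    let ⟨_, ⟨h⟩, _⟩ := exists_isLimit_mapCone_forgetC (limit.isLimit (F ⋙ forgetC π))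
    ⟨⟨⟨_, h⟩⟩⟩

instance [HasLimitsOfShape J C] : PreservesLimitsOfShape J (forgetC π) where
  preservesLimit {F} :=
    let ⟨_, ⟨h⟩, ⟨h'⟩⟩ := exists_isLimit_mapCone_forgetC (limit.isLimit (F ⋙ forgetC π))
    preservesLimit_of_preserves_limit_cone h h'

end Limits

section Colimits

variable {c : Cocone (F ⋙ forgetC π)}

/-- `c.ι.app j`, typed so that the operators on `F.obj j` can be composed with it. -/
def coconeInj (c : Cocone (F ⋙ forgetC π)) (j : J) : (F.obj j).X ⟶ c.pt :=
  c.ι.app j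

theorem map_coconeInj (c : Cocone (F ⋙ forgetC π)) {i j : J} (f : i ⟶ j) :
    toC (F.map f) ≫ coconeInj c j = coconeInj c i :=
  c.w f

theorem exists_coconeInj_desc (hc : IsColimit c) {Z : C} (k : ∀ j, (F.obj j).X ⟶ Z)
    (hk : ∀ {i j : J} (f : i ⟶ j), toC (F.map f) ≫ k j = k i) :
    ∃ l : c.pt ⟶ Z, ∀ j, coconeInj c j ≫ l = k j :=
  ⟨hc.desc ⟨Z, { app := k, naturality _ _ f := (hk f).trans (Category.comp_id _).symm }⟩,
    hc.fac _⟩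

theorem exists_colimit_ρ (hc : IsColimit c) (g : G) : ∃ r : c.pt ⟶ c.pt,
    ∀ j, coconeInj c j ≫ r = (F.obj j).ρ g ≫ coconeInj c j :=
  exists_coconeInj_desc hc _ fun f => by
    rw [← reassoc_of% ρ_toC, map_coconeInj]

variable [∀ Z : C, PreservesColimitsOfShape J (tensorLeft Z)]

theorem whiskerLeft_coconeInj_hom_ext (hc : IsColimit c) {Z Z' : C} {f g : Z ⊗ c.pt ⟶ Z'}
    (h : ∀ j, Z ◁ coconeInj c j ≫ f = Z ◁ coconeInj c j ≫ g) : f = g :=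
  (isColimitOfPreserves (tensorLeft Z) hc).hom_ext h

theorem exists_colimit_act (hc : IsColimit c) : ∃ m : A ⊗ c.pt ⟶ c.pt,
    ∀ j, A ◁ coconeInj c j ≫ m = (F.obj j).M.act ≫ coconeInj c j :=
  have h {i j : J} (f : i ⟶ j) : A ◁ toC (F.map f) ≫ (F.obj j).M.act ≫ coconeInj c j =
      (F.obj i).M.act ≫ coconeInj c i := by
    rw [← reassoc_of% act_toC, map_coconeInj]
  ⟨(isColimitOfPreserves (tensorLeft A) hc).desc
    ⟨c.pt, { app j := (F.obj j).M.act ≫ coconeInj c j,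
             naturality _ _ f := (h f).trans (Category.comp_id _).symm }⟩,
    (isColimitOfPreserves (tensorLeft A) hc).fac _⟩

theorem exists_isColimit_mapCocone_forgetC (hc : IsColimit c) : ∃ c' : Cocone F,
    Nonempty (IsColimit c') ∧ Nonempty (IsColimit ((forgetC π).mapCocone c')) := by
  obtain ⟨m, hm⟩ := exists_colimit_act hc
  choose r hr using exists_colimit_ρ hc
  let Q : EquivMod π :=
    ofJointlyEpi (V := F.obj) (coconeInj c) (whiskerLeft_coconeInj_hom_ext hc) m hm r hr
  let c' : Cocone F :=
    ⟨Q,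
      { app j := homMk (W := Q) (coconeInj c j) (IsSemilinear.id_iff.2 (hm j).symm)
          fun g => (hr g j).symm
        naturality _ _ f := hom_ext' (c.ι.naturality f) }⟩
  exact ⟨c',
    ⟨{ desc s := homOfJointlyEpi c'.ι.app (whiskerLeft_coconeInj_hom_ext hc)
          (hc.desc ((forgetC π).mapCocone s)) s.ι.app (hc.fac _)
       fac s j := hom_ext' (hc.fac _ j)
       uniq s l hl := hom_ext' <|
        hc.uniq ((forgetC π).mapCocone s) (toC l) fun j => congrArg toC (hl j) }⟩,
    ⟨hc⟩⟩

instance [HasColimitsOfShape J C] : HasColimitsOfShape J (EquivMod π) where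
  has_colimit F :=
    let ⟨_, ⟨h⟩, _⟩ := exists_isColimit_mapCocone_forgetC (colimit.isColimit (F ⋙ forgetC π))
    ⟨⟨⟨_, h⟩⟩⟩

instance [HasColimitsOfShape J C] : PreservesColimitsOfShape J (forgetC π) where
  preservesColimit {F} :=
    let ⟨_, ⟨h⟩, ⟨h'⟩⟩ := exists_isColimit_mapCocone_forgetC (colimit.isColimit (F ⋙ forgetC π))
    preservesColimit_of_preserves_colimit_cocone h h'

end Colimits

section Local

variable [BraidedCategory C]

theorem whiskerLeft_toC_monodromy_act {V W : EquivMod π} (f : V ⟶ W) :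
    A ◁ toC f ≫ (β_ A W.X).hom ≫ (β_ W.X A).hom ≫ W.M.act =
      (β_ A V.X).hom ≫ (β_ V.X A).hom ≫ V.M.act ≫ toC f := by
  rw [BraidedCategory.braiding_naturality_right_assoc,
    BraidedCategory.braiding_naturality_left_assoc, ← act_toC]

instance [HasLimitsOfShape J C] : (isLocal π).IsClosedUnderLimitsOfShape J where
  limitsOfShape_le := by
    rintro V ⟨p⟩
    refine (isLimitOfPreserves (forgetC π) p.isLimit).hom_ext fun j => ?_
    change (_ ≫ _ ≫ V.M.act) ≫ toC (p.π.app j) = V.M.act ≫ toC (p.π.app j)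
    have local_diag : _ = _ := p.prop_diag_obj j
    calc
      _ = A ◁ toC (p.π.app j) ≫ _ := by
        rw [Category.assoc, Category.assoc]
        exact (whiskerLeft_toC_monodromy_act (p.π.app j)).symm
      _ = A ◁ toC (p.π.app j) ≫ (p.diag.obj j).M.act := congrArg _ local_diag
      _ = _ := (act_toC (p.π.app j)).symm

instance [HasColimitsOfShape J C] [∀ Z : C, PreservesColimitsOfShape J (tensorLeft Z)] :
    (isLocal π).IsClosedUnderColimitsOfShape J where
  colimitsOfShape_le := by
    rintro V ⟨p⟩
    refine (isColimitOfPreserves (forgetC π ⋙ tensorLeft A) p.isColimit).hom_ext fun j => ?_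
    have local_diag : _ = _ := p.prop_diag_obj j
    calc
      A ◁ toC (p.ι.app j) ≫ (β_ A V.X).hom ≫ (β_ V.X A).hom ≫ V.M.act =
          (β_ A (p.diag.obj j).X).hom ≫ (β_ _ A).hom ≫ _ ≫ toC (p.ι.app j) :=
        whiskerLeft_toC_monodromy_act (p.ι.app j)
      _ = (p.diag.obj j).M.act ≫ toC (p.ι.app j) := by
        simpa only [Category.assoc] using congrArg (· ≫ toC (p.ι.app j)) local_diag
      _ = _ := act_toC (p.ι.app j)

end Local

end Forget

end EquivMod

section Abelian

theorem exists_abelian_of_reflectsIsomorphisms {E : Type*} [Category* E] [Preadditive E]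
    {C : Type*} [Category* C] [Abelian C] (F : E ⥤ C) [F.PreservesZeroMorphisms]
    [F.ReflectsIsomorphisms] [HasFiniteProducts E] [HasKernels E] [HasCokernels E]
    [∀ {X Y : E} (f : X ⟶ Y), PreservesLimit (parallelPair f 0) F]
    [∀ {X Y : E} (f : X ⟶ Y), PreservesColimit (parallelPair f 0) F] :
    ∃ ab : Abelian E, ab.toPreadditive = ‹Preadditive E› := by
  have {X Y : E} (f : X ⟶ Y) : IsIso (Abelian.coimageImageComparison f) := by
    have : IsIso (F.map (Abelian.coimageImageComparison f)) := by
      rw [Arrow.isIso_iff_isIso_of_isIso (Abelian.PreservesCoimageImageComparison.iso F f).hom]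
      infer_instance
    exact isIso_of_reflects_iso _ F
  exact ⟨Abelian.ofCoimageImageComparisonIsIso, rfl⟩

theorem exists_abelian_fullSubcategory {E : Type*} [Category* E] [inst : Preadditive E]
    (hE : ∃ ab : Abelian E, ab.toPreadditive = inst) (P : ObjectProperty E)
    [P.IsClosedUnderFiniteProducts] [P.IsClosedUnderLimitsOfShape WalkingParallelPair]
    [P.IsClosedUnderColimitsOfShape WalkingParallelPair] :
    ∃ ab : Abelian P.FullSubcategory,
      ab.toPreadditive = (inferInstance : Preadditive P.FullSubcategory) := by
  obtain ⟨ab, rfl⟩ := hE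
  have : P.IsClosedUnderKernels := ⟨by
    rintro _ ⟨f, k, hk, hf⟩
    exact P.prop_of_isLimit hk (by rintro (_ | _); exacts [hf.1, hf.2])⟩
  have : P.IsClosedUnderCokernels := ⟨by
    rintro _ ⟨f, k, hk, hf⟩
    exact P.prop_of_isColimit hk (by rintro (_ | _); exacts [hf.1, hf.2])⟩
  exact ⟨inferInstance, rfl⟩

end Abelian

section UnitScalar

variable {C : Type u} [Category.{v} C] [MonoidalCategory C] {A : C} [MonObj A] [Preadditive C]
  [MonoidalPreadditive C]

theorem eq_zero_of_one_eq_zero (h : η[A] = 0) {X : C} (f : X ⟶ A) : f = 0 := by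
  have id_eq_zero : 𝟙 A = 0 := by
    rw [← (λ_ A).inv_hom_id, ← one_mul A, h, MonoidalPreadditive.zero_whiskerRight, zero_comp,
      comp_zero]
  rw [← Category.comp_id f, id_eq_zero, comp_zero]

variable [Linear ℂ C]

theorem one_ne_zero_of_finrank (h : Module.finrank ℂ (𝟙_ C ⟶ A) = 1) : η[A] ≠ 0 := by
  have := Module.nontrivial_of_finrank_eq_succ h
  obtain ⟨f, hf⟩ := exists_ne (0 : 𝟙_ C ⟶ A)
  exact fun h0 => hf (eq_zero_of_one_eq_zero h0 f)

theorem exists_eq_smul_one (h : Module.finrank ℂ (𝟙_ C ⟶ A) = 1) (f : 𝟙_ C ⟶ A) :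
    ∃ c : ℂ, f = c • η[A] :=
  (exists_smul_eq_of_finrank_eq_one h (one_ne_zero_of_finrank h) f).imp fun _ => Eq.symm

end UnitScalar

namespace EquivMod

section Linear

variable {C : Type u} [Category.{v} C] [MonoidalCategory C] {G : Type w} [Group G] {A : C}
  [MonObj A] {π : AlgAction G A} [Preadditive C] [Linear ℂ C] [MonoidalPreadditive C]
  [MonoidalLinear ℂ C]

@[simp]
theorem toC_zero (V W : EquivMod π) : toC (0 : V ⟶ W) = 0 :=
  rfl

@[simp]
theorem toC_add {V W : EquivMod π} (f g : V ⟶ W) : toC (f + g) = toC f + toC g :=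
  rfl

@[simp]
theorem toC_smul {V W : EquivMod π} (c : ℂ) (f : V ⟶ W) : toC (c • f) = c • toC f :=
  rfl

instance : (forgetC π).Additive where

instance : (forgetC π).Linear ℂ where

theorem finiteDimensional_hom (hfin : ∀ X Y : C, FiniteDimensional ℂ (X ⟶ Y))
    (V W : EquivMod π) : FiniteDimensional ℂ (V ⟶ W) :=
  have := hfin V.X W.X
  FiniteDimensional.of_injective ((forgetC π).mapLinearMap ℂ) (forgetC π).map_injective

end Linear

section Abelian

variable {C : Type u} [Category.{v} C] [MonoidalCategory C] {G : Type w} [Group G] {A : C}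
  [MonObj A] (π : AlgAction G A) [Abelian C] [Linear ℂ C] [MonoidalPreadditive C]
  [MonoidalLinear ℂ C]
  [∀ Z : C, PreservesColimitsOfShape WalkingParallelPair (tensorLeft Z)]

theorem exists_abelian :
    ∃ ab : Abelian (EquivMod π), ab.toPreadditive = (inferInstance : Preadditive (EquivMod π)) :=
  have : HasFiniteProducts (EquivMod π) := ⟨fun _ => inferInstance⟩
  have : HasKernels (EquivMod π) := ⟨inferInstance⟩
  have : HasCokernels (EquivMod π) := ⟨inferInstance⟩
  exists_abelian_of_reflectsIsomorphisms (forgetC π)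

theorem exists_abelian_isLocal [BraidedCategory C] :
    ∃ ab : Abelian (isLocal π).FullSubcategory,
      ab.toPreadditive = (inferInstance : Preadditive (isLocal π).FullSubcategory) :=
  have : (isLocal π).IsClosedUnderFiniteProducts := ⟨fun _ => inferInstance⟩
  exists_abelian_fullSubcategory (exists_abelian π) (isLocal π)

end Abelian

section TensorCategory

variable {C : Type u} [Category.{v} C] [MonoidalCategory C] [BraidedCategory C] {G : Type w}
  [Group G] {A : C} [MonObj A] {π : AlgAction G A} [IsCommMonObj A] [Preadditive C] [Linear ℂ C]
  [MonoidalPreadditive C] [MonoidalLinear ℂ C] [HasCoequalizers C]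
  [∀ Z : C, PreservesColimitsOfShape WalkingParallelPair (tensorLeft Z)]

instance : MonoidalPreadditive (EquivMod π) where
  whiskerLeft_zero := tensorObj_hom_ext (by simp)
  zero_whiskerRight := tensorObj_hom_ext (by simp)
  whiskerLeft_add _ _ := tensorObj_hom_ext (by simp [Preadditive.comp_add])
  add_whiskerRight _ _ := tensorObj_hom_ext (by simp [Preadditive.comp_add])

instance : MonoidalLinear ℂ (EquivMod π) where
  whiskerLeft_smul _ _ _ _ _ := tensorObj_hom_ext (by simp)
  smul_whiskerRight _ _ _ _ _ := tensorObj_hom_ext (by simp)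

theorem finrank_end_unit (h : Module.finrank ℂ (𝟙_ C ⟶ A) = 1) :
    Module.finrank ℂ (𝟙_ (EquivMod π) ⟶ 𝟙_ (EquivMod π)) = 1 := by
  refine finrank_eq_one (𝟙 _) (fun h0 => ?_) fun f => ?_
  · have id_eq_zero : 𝟙 A = 0 := congrArg toC h0
    exact one_ne_zero_of_finrank h (by rw [← Category.comp_id η[A], id_eq_zero, comp_zero])
  · obtain ⟨c, hc⟩ := exists_eq_smul_one h (η[A] ≫ toC f)
    refine ⟨c, unit_hom_ext ?_⟩
    rw [hc, toC_smul, Linear.comp_smul]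
    exact congrArg (c • ·) (Category.comp_id η[A])

end TensorCategory

section TensorCategoryAbelian

variable {C : Type u} [Category.{v} C] [MonoidalCategory C] [BraidedCategory C] {G : Type w}
  [Group G] {A : C} [MonObj A] (π : AlgAction G A) [IsCommMonObj A] [Abelian C] [Linear ℂ C]
  [MonoidalPreadditive C] [MonoidalLinear ℂ C]
  [∀ Z : C, PreservesColimitsOfShape WalkingParallelPair (tensorLeft Z)]
  (hfin : ∀ X Y : C, FiniteDimensional ℂ (X ⟶ Y)) (h : Module.finrank ℂ (𝟙_ C ⟶ A) = 1)

include hfin h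

theorem isTensorCategory : IsTensorCategory (EquivMod π) where
  abelian := exists_abelian π
  bilinear := ⟨inferInstance, inferInstance⟩
  finiteDimensional := finiteDimensional_hom hfin
  unit := finrank_end_unit h

theorem isTensorCategory_isLocal [(isLocal π).IsMonoidal] :
    IsTensorCategory (isLocal π).FullSubcategory where
  abelian := exists_abelian_isLocal π
  bilinear := ⟨inferInstance, inferInstance⟩
  finiteDimensional V W :=
    have : FiniteDimensional ℂ ((isLocal π).ι.obj V ⟶ (isLocal π).ι.obj W) :=
      finiteDimensional_hom hfin V.obj W.obj
    FiniteDimensional.of_injective ((isLocal π).ι.mapLinearMap ℂ (X := V) (Y := W))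
      (isLocal π).ι.map_injective
  unit :=
    (LinearEquiv.ofBijective
      ((isLocal π).ι.mapLinearMap ℂ (X := 𝟙_ (isLocal π).FullSubcategory) (Y := 𝟙_ _))
      ⟨(isLocal π).ι.map_injective, (isLocal π).ι.map_surjective⟩).finrank_eq.trans
      (finrank_end_unit h)

end TensorCategoryAbelian

end EquivMod

section Pairing

variable {C : Type u} [Category.{v} C] [MonoidalCategory C] {X Y Z : C} [ExactPairing X Y]

variable (X Y) in
/-- The morphism to the first object of a dual pair which corresponds to a pairing of its source
with the second one. -/
def curryLeft (f : Y ⊗ Z ⟶ 𝟙_ C) : Z ⟶ X :=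
  tensorLeftHomEquiv Z X Y (𝟙_ C) f ≫ (ρ_ X).hom

variable (X Y) in
/-- The morphism to the second object of a dual pair which corresponds to a pairing of its source
with the first one. -/
def curryRight (f : Z ⊗ X ⟶ 𝟙_ C) : Z ⟶ Y :=
  tensorRightHomEquiv Z X Y (𝟙_ C) f ≫ (λ_ Y).hom

theorem curryLeft_whiskerLeft_evaluation (f : Z ⟶ X) : curryLeft X Y (Y ◁ f ≫ ε_ X Y) = f :=
  (Iso.eq_comp_inv _).1 (@tensorLeftHomEquiv_whiskerLeft_comp_evaluation C _ _ Z Y ⟨X⟩ f)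

theorem curryRight_whiskerRight_evaluation (f : Z ⟶ Y) :
    curryRight X Y (f ▷ X ≫ ε_ X Y) = f :=
  (Iso.eq_comp_inv _).1 (@tensorRightHomEquiv_whiskerRight_comp_evaluation C _ _ X Z ⟨Y⟩ f)

theorem whiskerLeft_curryLeft_evaluation (f : Y ⊗ Z ⟶ 𝟙_ C) : Y ◁ curryLeft X Y f ≫ ε_ X Y = f :=
  (tensorLeftHomEquiv Z X Y _).injective <|
    (cancel_mono (ρ_ X).hom).1 (curryLeft_whiskerLeft_evaluation (curryLeft X Y f))

theorem whiskerRight_curryRight_evaluation (f : Z ⊗ X ⟶ 𝟙_ C) :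
    curryRight X Y f ▷ X ≫ ε_ X Y = f :=
  (tensorRightHomEquiv Z X Y _).injective <|
    (cancel_mono (λ_ Y).hom).1 (curryRight_whiskerRight_evaluation (curryRight X Y f))

theorem hom_ext_whiskerLeft_evaluation {f g : Z ⟶ X} (h : Y ◁ f ≫ ε_ X Y = Y ◁ g ≫ ε_ X Y) :
    f = g := by
  rw [← curryLeft_whiskerLeft_evaluation (Y := Y) f, h, curryLeft_whiskerLeft_evaluation]

theorem hom_ext_whiskerRight_evaluation {f g : Z ⟶ Y} (h : f ▷ X ≫ ε_ X Y = g ▷ X ≫ ε_ X Y) :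
    f = g := by
  rw [← curryRight_whiskerRight_evaluation (X := X) f, h, curryRight_whiskerRight_evaluation]

theorem comp_curryLeft {Z' : C} (g : Z' ⟶ Z) (f : Y ⊗ Z ⟶ 𝟙_ C) :
    g ≫ curryLeft X Y f = curryLeft X Y (Y ◁ g ≫ f) :=
  hom_ext_whiskerLeft_evaluation (Y := Y) <| by
    rw [whiskerLeft_comp_assoc, whiskerLeft_curryLeft_evaluation, whiskerLeft_curryLeft_evaluation]

theorem comp_curryRight {Z' : C} (g : Z' ⟶ Z) (f : Z ⊗ X ⟶ 𝟙_ C) :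
    g ≫ curryRight X Y f = curryRight X Y (g ▷ X ≫ f) :=
  hom_ext_whiskerRight_evaluation (X := X) <| by
    rw [comp_whiskerRight_assoc, whiskerRight_curryRight_evaluation,
      whiskerRight_curryRight_evaluation]

theorem coevaluation_braiding_evaluation_eq [BraidedCategory C] {X Y₁ Y₂ : C}
    (p₁ : ExactPairing X Y₁) (p₂ : ExactPairing X Y₂) :
    η_ X Y₁ ≫ (β_ X Y₁).hom ≫ ε_ X Y₁ = η_ X Y₂ ≫ (β_ X Y₂).hom ≫ ε_ X Y₂ := by
  have coevaluation_iso : η_ X Y₁ ≫ X ◁ (rightDualIso p₁ p₂).hom = η_ X Y₂ := by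
    have := @coevaluation_comp_rightAdjointMate C _ _ X X ⟨Y₂⟩ ⟨Y₁⟩ (𝟙 X)
    rwa [id_whiskerRight, Category.comp_id] at this
  have iso_evaluation : (rightDualIso p₁ p₂).hom ▷ X ≫ ε_ X Y₂ = ε_ X Y₁ := by
    have := @rightAdjointMate_comp_evaluation C _ _ X X ⟨Y₂⟩ ⟨Y₁⟩ (𝟙 X)
    rwa [whiskerLeft_id, Category.id_comp] at this
  rw [← coevaluation_iso, Category.assoc, BraidedCategory.braiding_naturality_right_assoc,
    iso_evaluation]

theorem coevaluation_tensorHom {f f' : X ⟶ X} {g g' : Y ⟶ Y} (hf : f ≫ f' = 𝟙 X)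
    (hg : g' ≫ g = 𝟙 Y) (h : (g' ⊗ₘ f') ≫ ε_ X Y = ε_ X Y) :
    η_ X Y ≫ (f ⊗ₘ g) = η_ X Y := by
  let : HasRightDual X := ⟨Y⟩
  have mate_eq : (fᘁ : Y ⟶ Y) = g' := hom_ext_whiskerRight_evaluation (X := X) <| by
    refine (rightAdjointMate_comp_evaluation f).trans ?_
    change Y ◁ f ≫ ε_ X Y = _
    rw [← h, whiskerLeft_comp_tensorHom_assoc, hf, tensorHom_id]
    rfl
  have coevaluation_mate : η_ X Y ≫ X ◁ g' = η_ X Y ≫ f ▷ Y :=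
    mate_eq ▸ coevaluation_comp_rightAdjointMate f
  rw [MonoidalCategory.tensorHom_def, ← reassoc_of% coevaluation_mate, ← whiskerLeft_comp, hg,
    whiskerLeft_id, Category.comp_id]

end Pairing

section Frobenius

variable {C : Type u} [Category.{v} C] [MonoidalCategory C] {A : C} [MonObj A] [ExactPairing A A]
  {ε : A ⟶ 𝟙_ C}

/-- The `A`-linear morphism `Z ⟶ A` which corresponds to `f : Z ⟶ 1` under the self-duality of
`A`. -/
def regularLift (Z : Mod C A) (f : Z.X ⟶ 𝟙_ C) : Z.X ⟶ A :=
  curryLeft A A (Z.act ≫ f)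

section Lift

variable (he : ε_ A A = μ[A] ≫ ε)

include he

theorem whiskerLeft_regularLift (Z : Mod C A) (f : Z.X ⟶ 𝟙_ C) :
    A ◁ regularLift Z f ≫ μ[A] ≫ ε = Z.act ≫ f := by
  rw [← he, regularLift, whiskerLeft_curryLeft_evaluation]

theorem isSemilinear_regularLift (Z : Mod C A) (f : Z.X ⟶ 𝟙_ C) :
    IsSemilinear (W := regularMod A) (𝟙 A) (regularLift Z f) := by
  refine IsSemilinear.id_iff.2 (hom_ext_whiskerLeft_evaluation (Y := A) ?_)
  change _ = A ◁ (A ◁ regularLift Z f ≫ μ[A]) ≫ _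
  rw [he, whiskerLeft_comp_assoc, whiskerLeft_comp_assoc, whiskerLeft_regularLift he,
    reassoc_of% act_act, ← whiskerLeft_regularLift he, ← whisker_exchange_assoc,
    MonObj.mul_assoc_assoc, associator_naturality_right_assoc, Iso.inv_hom_id_assoc]

theorem regularLift_comp (Z : Mod C A) (f : Z.X ⟶ 𝟙_ C) : regularLift Z f ≫ ε = f := by
  rw [← cancel_epi (λ_ Z.X).hom, ← leftUnitor_naturality_assoc, ← one_mul_assoc,
    whisker_exchange_assoc, whiskerLeft_regularLift he, reassoc_of% one_act]

theorem IsSemilinear.ext_counit {a : A ⟶ A} [IsIso a] {Z : Mod C A} {f g : Z.X ⟶ A}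
    (hf : IsSemilinear (W := regularMod A) a f) (hg : IsSemilinear (W := regularMod A) a g)
    (h : f ≫ ε = g ≫ ε) : f = g := by
  refine hom_ext_whiskerLeft_evaluation (Y := A) ((cancel_epi (a ▷ Z.X)).1 ?_)
  have act_comp_counit {k : Z.X ⟶ A} (hk : IsSemilinear (W := regularMod A) a k) :
      a ▷ Z.X ≫ A ◁ k ≫ ε_ A A = Z.act ≫ k ≫ ε := by
    rw [he, reassoc_of% hk, MonoidalCategory.tensorHom_def_assoc, regularMod_act]
  rw [act_comp_counit hf, h, act_comp_counit hg]

variable [BraidedCategory C] [IsCommMonObj A]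

theorem regularLift_eq_curryRight (Z : Mod C A) (f : Z.X ⟶ 𝟙_ C) :
    regularLift Z f = curryRight A A (rightAct Z ≫ f) := by
  have rightAct_lift : rightAct Z ≫ regularLift Z f = regularLift Z f ▷ A ≫ μ[A] := by
    have := (isSemilinear_regularLift he Z f).rightAct
    rwa [regularMod_rightAct, tensorHom_id] at this
  conv_rhs => rw [← regularLift_comp he Z f, reassoc_of% rightAct_lift, ← he,
    curryRight_whiskerRight_evaluation]

theorem monodromy_act_comp (Z : Mod C A) (f : Z.X ⟶ 𝟙_ C) :
    (β_ A Z.X).hom ≫ (β_ Z.X A).hom ≫ Z.act ≫ f = Z.act ≫ f := by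
  rw [← whiskerLeft_regularLift he, ← BraidedCategory.braiding_naturality_left_assoc,
    ← BraidedCategory.braiding_naturality_right_assoc, IsCommMonObj.mul_comm_assoc,
    IsCommMonObj.mul_comm_assoc]

end Lift

theorem coevaluation_curryLeft_act (X : C) (W : Mod C A) [ExactPairing X W.X] :
    W.X ◁ η_ X W.X ≫ (α_ _ _ _).inv ≫
      curryLeft A A ((α_ A W.X X).inv ≫ W.act ▷ X ≫ ε_ X W.X) ▷ W.X ≫ W.act =
    (ρ_ W.X).hom ≫ (λ_ W.X).inv ≫ (η_ A A ≫ μ[A]) ▷ W.X ≫ W.act := by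
  rw [comp_whiskerRight_assoc, mul_act]
  simp only [curryLeft, tensorLeftHomEquiv, Equiv.coe_fn_mk]
  calc _ = 𝟙 _ ⊗≫ (𝟙_ C ◁ (W.X ◁ η_ X W.X) ≫ η_ A A ▷ (W.X ⊗ X ⊗ W.X)) ⊗≫
          A ◁ W.act ▷ X ▷ W.X ⊗≫ A ◁ ε_ X W.X ▷ W.X ⊗≫ W.act := by monoidal
    _ = 𝟙 _ ⊗≫ η_ A A ▷ W.X ⊗≫ A ◁ ((A ⊗ W.X) ◁ η_ X W.X ≫ W.act ▷ (X ⊗ W.X)) ⊗≫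
          A ◁ ε_ X W.X ▷ W.X ⊗≫ W.act := by rw [whisker_exchange]; monoidal
    _ = 𝟙 _ ⊗≫ η_ A A ▷ W.X ⊗≫ A ◁ W.act ⊗≫ A ◁ (W.X ◁ η_ X W.X ⊗≫ ε_ X W.X ▷ W.X) ⊗≫
          W.act := by rw [whisker_exchange]; monoidal
    _ = _ := by rw [ExactPairing.coevaluation_evaluation'']; monoidal

theorem coevaluation_curryRight_rightAct [BraidedCategory C] [IsCommMonObj A] (V : Mod C A) (Y : C)
    [ExactPairing V.X Y] :
    η_ V.X Y ▷ V.X ≫ (α_ _ _ _).hom ≫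
      V.X ◁ curryRight A A ((α_ Y V.X A).hom ≫ Y ◁ rightAct V ≫ ε_ V.X Y) ≫ rightAct V =
    (λ_ V.X).hom ≫ (ρ_ V.X).inv ≫ V.X ◁ (η_ A A ≫ μ[A]) ≫ rightAct V := by
  rw [whiskerLeft_comp_assoc, mul_rightAct]
  simp only [curryRight, tensorRightHomEquiv, Equiv.coe_fn_mk]
  calc _ = 𝟙 _ ⊗≫ (η_ V.X Y ▷ (V.X ⊗ 𝟙_ C) ≫ (V.X ⊗ Y) ◁ (V.X ◁ η_ A A)) ⊗≫
          V.X ◁ Y ◁ rightAct V ▷ A ⊗≫ V.X ◁ ε_ V.X Y ▷ A ⊗≫ rightAct V := by monoidal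
    _ = 𝟙 _ ⊗≫ V.X ◁ η_ A A ⊗≫ (η_ V.X Y ▷ (V.X ⊗ A) ≫ (V.X ⊗ Y) ◁ rightAct V) ▷ A ⊗≫
          V.X ◁ ε_ V.X Y ▷ A ⊗≫ rightAct V := by rw [← whisker_exchange]; monoidal
    _ = 𝟙 _ ⊗≫ V.X ◁ η_ A A ⊗≫ rightAct V ▷ A ⊗≫
          (η_ V.X Y ▷ V.X ⊗≫ V.X ◁ ε_ V.X Y) ▷ A ⊗≫ rightAct V := by
        rw [← whisker_exchange]; monoidal
    _ = _ := by rw [ExactPairing.evaluation_coevaluation'']; monoidal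

end Frobenius

theorem AlgAction.π_comp_π_inv {C : Type u} [Category.{v} C] [MonoidalCategory C] {A : C} [MonObj A]
    {G : Type w} [Group G] (π : AlgAction G A) (g : G) :
    (π.π g : A ⟶ A) ≫ (π.π g⁻¹ : A ⟶ A) = 𝟙 A := by
  rw [← End.mul_def, ← map_mul, inv_mul_cancel, map_one, End.one_def]

section Scalars

variable {C : Type u} [Category.{v} C] [MonoidalCategory C] {A : C} [MonObj A] [Preadditive C]
  [Linear ℂ C] [MonoidalPreadditive C] {ε : A ⟶ 𝟙_ C} (h : Module.finrank ℂ (𝟙_ C ⟶ A) = 1)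

include h

theorem exists_coevaluation_mul_eq_smul_one [BraidedCategory C] [IsCommMonObj A]
    [ExactPairing A A] [RightRigidCategory C] {t : BraidedTwist C} (hθ : t.app A = 𝟙 A)
    (he : ε_ A A = μ[A] ≫ ε) (hdim : t.dim A ≠ 0) :
    ∃ c : ℂ, c ≠ 0 ∧ η_ A A ≫ μ[A] = c • η[A] := by
  obtain ⟨c, hc⟩ := exists_eq_smul_one h (η_ A A ≫ μ[A])
  refine ⟨c, ?_, hc⟩
  rintro rfl
  apply hdim
  rw [BraidedTwist.dim, hθ, id_whiskerRight, Category.id_comp,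
    coevaluation_braiding_evaluation_eq inferInstance ‹ExactPairing A A›, he,
    IsCommMonObj.mul_comm_assoc, reassoc_of% hc, zero_smul, zero_comp]

variable (hη : η[A] ≫ ε = 𝟙 (𝟙_ C))

include hη

theorem eq_one_of_comp_counit {u : 𝟙_ C ⟶ A} (hu : u ≫ ε = 𝟙 (𝟙_ C)) : u = η[A] := by
  obtain ⟨c, rfl⟩ := exists_eq_smul_one h u
  rw [Linear.smul_comp, hη] at hu
  calc c • η[A] = (c • 𝟙 (𝟙_ C)) ≫ η[A] := by rw [Linear.smul_comp, Category.id_comp]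
    _ = η[A] := by rw [hu, Category.id_comp]

variable [ExactPairing A A] (he : ε_ A A = μ[A] ≫ ε)

include he

theorem eq_counit_of_one_comp {f : A ⟶ 𝟙_ C} (hf : η[A] ≫ f = 𝟙 (𝟙_ C)) : f = ε := by
  have lift_eq_id : regularLift (regularMod A) f = 𝟙 A := by
    refine (isSemilinear_regularLift he (regularMod A) f).ext_one (IsSemilinear.id _) ?_
    refine (eq_one_of_comp_counit h hη ?_).trans (Category.comp_id _).symm
    rw [Category.assoc, regularLift_comp he, hf]
  rw [← regularLift_comp he (regularMod A) f, lift_eq_id, Category.id_comp]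

theorem AlgAction.comp_counit {G : Type w} [Group G] (π : AlgAction G A) (g : G) :
    (π.π g : A ⟶ A) ≫ ε = ε :=
  eq_counit_of_one_comp h hη he (by rw [reassoc_of% (π.isMonHom g).one_hom, hη])

end Scalars

namespace EquivMod

section RegularLift

variable {C : Type u} [Category.{v} C] [MonoidalCategory C] {G : Type w} [Group G] {A : C}
  [MonObj A] {π : AlgAction G A} [ExactPairing A A] {ε : A ⟶ 𝟙_ C}

theorem ρ_regularLift (he : ε_ A A = μ[A] ≫ ε) (hε : ∀ g, (π.π g : A ⟶ A) ≫ ε = ε)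
    {Z : EquivMod π} {f : Z.X ⟶ 𝟙_ C} (hf : ∀ g, Z.ρ g ≫ f = f) (g : G) :
    Z.ρ g ≫ regularLift Z.M f = regularLift Z.M f ≫ (π.π g : A ⟶ A) := by
  have := π.isMonHom g
  have : IsIso (π.π g : A ⟶ A) :=
    ⟨(π.π g⁻¹ : A ⟶ A), π.π_comp_π_inv g, by simpa using π.π_comp_π_inv g⁻¹⟩
  have lift_linear := isSemilinear_regularLift he Z.M f
  have ρ_lift := (Z.isSemilinear_ρ g).comp lift_linear
  have lift_π := lift_linear.comp (IsSemilinear.regular (π.π g : A ⟶ A))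
  rw [Category.comp_id] at ρ_lift
  rw [Category.id_comp] at lift_π
  refine ρ_lift.ext_counit he lift_π ?_
  rw [Category.assoc, Category.assoc, hε, regularLift_comp he, hf]

end RegularLift

section Duality

variable {C : Type u} [Category.{v} C] [MonoidalCategory C] [BraidedCategory C] {G : Type w}
  [Group G] {A : C} [MonObj A] {π : AlgAction G A}

/-- A pairing in `C` of two objects of `𝒟` which is balanced over `A` and invariant under `G`, and
so induces a pairing of `𝒟` with values in `(A, π)`. -/
structure IsInvariantPairing (V W : EquivMod π) (p : V.X ⊗ W.X ⟶ 𝟙_ C) : Prop where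
  balanced : IsBalanced V.M W.M p
  invariant : ∀ g, (V.ρ g ⊗ₘ W.ρ g) ≫ p = p

variable [IsCommMonObj A] [HasCoequalizers C]
  [∀ Z : C, PreservesColimitsOfShape WalkingParallelPair (tensorLeft Z)]

/-- The morphism of `C` out of `V ⊗_A W` induced by a balanced morphism out of `V ⊗ W`. -/
noncomputable def desc {V W : EquivMod π} {Z : C} (f : V.X ⊗ W.X ⟶ Z)
    (hf : IsBalanced V.M W.M f) : (V ⊗ W).X ⟶ Z :=
  relDesc f hf

theorem proj_desc {V W : EquivMod π} {Z : C} (f : V.X ⊗ W.X ⟶ Z) (hf : IsBalanced V.M W.M f) :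
    proj V W ≫ desc f hf = f :=
  relProj_relDesc f hf

/-- The morphism `A ⟶ Z` of `𝒟` which corresponds to an invariant morphism `1 ⟶ Z` of `C`. -/
noncomputable def fromUnit (Z : EquivMod π) (u : 𝟙_ C ⟶ Z.X) (hu : ∀ g, u ≫ Z.ρ g = u) :
    𝟙_ (EquivMod π) ⟶ Z :=
  homMk (V := 𝟙_ (EquivMod π)) ((ρ_ A).inv ≫ A ◁ u ≫ Z.M.act)
    (IsSemilinear.id_iff.2 (by
      change μ[A] ≫ (ρ_ A).inv ≫ _ = A ◁ _ ≫ _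
      rw [rightUnitor_inv_naturality_assoc, ← whisker_exchange_assoc, mul_act]
      simp))
    (fun g => by
      change (π.π g : A ⟶ A) ≫ _ = _
      rw [Category.assoc, Category.assoc, Z.isSemilinear_ρ g, whiskerLeft_comp_tensorHom_assoc,
        hu, rightUnitor_inv_naturality_assoc, MonoidalCategory.tensorHom_def_assoc])

theorem one_fromUnit (Z : EquivMod π) (u : 𝟙_ C ⟶ Z.X) (hu : ∀ g, u ≫ Z.ρ g = u) :
    η[A] ≫ toC (fromUnit Z u hu) = u := by
  change η[A] ≫ (ρ_ A).inv ≫ A ◁ u ≫ Z.M.act = u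
  rw [rightUnitor_inv_naturality_assoc, ← whisker_exchange_assoc, one_act]
  simp [unitors_equal]

section Copairing

variable {V W : EquivMod π} [ExactPairing V.X W.X] (h : IsInvariantPairing W V (ε_ V.X W.X))

include h in
theorem IsInvariantPairing.coevaluation_ρ (g : G) :
    (η_ V.X W.X ≫ proj V W) ≫ (V ⊗ W).ρ g = η_ V.X W.X ≫ proj V W := by
  have hV : V.ρ g ≫ V.ρ g⁻¹ = 𝟙 V.X := by rw [← ρ_mul, inv_mul_cancel, ρ_one]
  have hW : W.ρ g⁻¹ ≫ W.ρ g = 𝟙 W.X := by rw [← ρ_mul, mul_inv_cancel, ρ_one]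
  rw [Category.assoc, proj_ρ, reassoc_of% coevaluation_tensorHom hV hW (h.invariant g⁻¹)]

/-- The morphism `A ⟶ V ⊗_A W` of `𝒟` induced by the coevaluation of `C`. -/
noncomputable def copairing : 𝟙_ (EquivMod π) ⟶ V ⊗ W :=
  fromUnit (V ⊗ W) (η_ V.X W.X ≫ proj V W) h.coevaluation_ρ

theorem one_copairing : η[A] ≫ toC (copairing h) = η_ V.X W.X ≫ proj V W :=
  one_fromUnit _ _ _

end Copairing

variable [ExactPairing A A] {ε : A ⟶ 𝟙_ C} (he : ε_ A A = μ[A] ≫ ε)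

include he in
theorem hom_ext_counit {Z : EquivMod π} {f g : Z ⟶ 𝟙_ (EquivMod π)}
    (h : (toC f : Z.X ⟶ A) ≫ ε = (toC g : Z.X ⟶ A) ≫ ε) : f = g :=
  hom_ext' (IsSemilinear.ext_counit he (isSemilinear_toC f) (isSemilinear_toC g) h)

variable (hε : ∀ g, (π.π g : A ⟶ A) ≫ ε = ε)

/-- The morphism `Z ⟶ A` of `𝒟` which corresponds to an invariant morphism `Z ⟶ 1` of `C` under the
self-duality of `A`. -/
noncomputable def toUnit (Z : EquivMod π) (f : Z.X ⟶ 𝟙_ C) (hf : ∀ g, Z.ρ g ≫ f = f) :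
    Z ⟶ 𝟙_ (EquivMod π) :=
  homMk (W := 𝟙_ (EquivMod π)) (regularLift Z.M f) (isSemilinear_regularLift he Z.M f)
    (ρ_regularLift he hε hf)

section Pairing

variable {V W : EquivMod π} {p : V.X ⊗ W.X ⟶ 𝟙_ C} (h : IsInvariantPairing V W p)

/-- The pairing `V ⊗_A W ⟶ A` of `𝒟` induced by an invariant pairing of `C`. -/
noncomputable def pairing : V ⊗ W ⟶ 𝟙_ (EquivMod π) :=
  toUnit he hε (V ⊗ W) (desc p h.balanced) fun g => (cancel_epi (proj V W)).1 <| by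
    rw [reassoc_of% proj_ρ, proj_desc, h.invariant]

theorem proj_pairing_counit :
    proj V W ≫ (toC (pairing he hε h) : (V ⊗ W).X ⟶ A) ≫ ε = p :=
  (congrArg (proj V W ≫ ·) (regularLift_comp he _ _)).trans (proj_desc p h.balanced)

theorem proj_pairing_eq_curryLeft : proj V W ≫ toC (pairing he hε h) =
    curryLeft A A ((α_ A V.X W.X).inv ≫ V.M.act ▷ W.X ≫ p) := by
  change (proj V W ≫ regularLift (V ⊗ W).M (desc p h.balanced) : _ ⟶ A) = _
  rw [regularLift, comp_curryLeft, reassoc_of% proj_act, proj_desc]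

theorem proj_pairing_eq_curryRight : proj V W ≫ toC (pairing he hε h) =
    curryRight A A ((α_ V.X W.X A).hom ≫ V.X ◁ rightAct W.M ≫ p) := by
  change (proj V W ≫ regularLift (V ⊗ W).M (desc p h.balanced) : _ ⟶ A) = _
  rw [regularLift_eq_curryRight he, comp_curryRight, reassoc_of% proj_rightAct, proj_desc]

end Pairing

variable [Preadditive C] [Linear ℂ C] [MonoidalPreadditive C] [MonoidalLinear ℂ C]
  {V W : EquivMod π} [ExactPairing V.X W.X] (h : IsInvariantPairing W V (ε_ V.X W.X))
  {c : ℂ} (hc : η_ A A ≫ μ[A] = c • η[A])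

include hc

theorem copairing_pairing :
    W ◁ copairing h ≫ (α_ W V W).inv ≫ pairing he hε h ▷ W =
      c • ((ρ_ W).hom ≫ (λ_ W).inv) := by
  rw [← cancel_epi (ρ_ W).inv, ← cancel_mono (λ_ W).hom]
  trans c • 𝟙 W
  swap
  · simp
  refine hom_ext' ?_
  have whiskered : W.X ◁ η[A] ≫ W.X ◁ toC (copairing h) = W.X ◁ η_ V.X W.X ≫ W.X ◁ proj V W := by
    rw [← whiskerLeft_comp, ← whiskerLeft_comp]
    exact congrArg (W.X ◁ ·) (one_copairing h)
  simp only [toC_comp, toC_rightUnitor_inv, Category.assoc]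
  rw [reassoc_of% proj_whiskerLeft, reassoc_of% whiskered, reassoc_of% proj_associator_inv,
    reassoc_of% proj_whiskerRight, proj_leftUnitor_hom, ← comp_whiskerRight_assoc,
    proj_pairing_eq_curryLeft, coevaluation_curryLeft_act, hc]
  simp

theorem pairing_copairing :
    copairing h ▷ V ≫ (α_ V W V).hom ≫ V ◁ pairing he hε h =
      c • ((λ_ V).hom ≫ (ρ_ V).inv) := by
  rw [← cancel_epi (λ_ V).inv, ← cancel_mono (ρ_ V).hom]
  trans c • 𝟙 V
  swap
  · simp
  refine hom_ext' ?_
  have whiskered : η[A] ▷ V.X ≫ toC (copairing h) ▷ V.X = η_ V.X W.X ▷ V.X ≫ proj V W ▷ V.X := by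
    rw [← comp_whiskerRight, ← comp_whiskerRight]
    exact congrArg (· ▷ V.X) (one_copairing h)
  simp only [toC_comp, toC_leftUnitor_inv, Category.assoc]
  rw [reassoc_of% proj_whiskerRight, reassoc_of% whiskered, reassoc_of% proj_associator_hom,
    reassoc_of% proj_whiskerLeft, proj_rightUnitor_hom, ← whiskerLeft_comp_assoc,
    proj_pairing_eq_curryRight, coevaluation_curryRight_rightAct, hc]
  simp [one_rightAct]

/-- A dual pair of `C` with balanced and invariant evaluation is a dual pair of `𝒟`. The
coevaluation has to be divided by the scalar `c` of the loop `1 ⟶ A ⊗ A ⟶ A`. -/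
noncomputable abbrev exactPairing (hc0 : c ≠ 0) : ExactPairing V W where
  coevaluation' := c⁻¹ • copairing h
  evaluation' := pairing he hε h
  coevaluation_evaluation' := by
    rw [MonoidalLinear.whiskerLeft_smul, Linear.smul_comp, copairing_pairing he hε h hc, smul_smul,
      inv_mul_cancel₀ hc0, one_smul]
  evaluation_coevaluation' := by
    rw [MonoidalLinear.smul_whiskerRight, Linear.smul_comp, pairing_copairing he hε h hc,
      smul_smul, inv_mul_cancel₀ hc0, one_smul]

end Duality

end EquivMod

section DualModules

variable {C : Type u} [Category.{v} C] [MonoidalCategory C] {A : C} [MonObj A]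

/-- The right action of `A` on the right dual of a module, transposed from the left action. -/
def rightDualAct (V : Mod C A) [HasRightDual V.X] : (V.X)ᘁ ⊗ A ⟶ (V.X)ᘁ :=
  curryRight V.X (V.X)ᘁ ((α_ (V.X)ᘁ A V.X).hom ≫ (V.X)ᘁ ◁ V.act ≫ ε_ V.X (V.X)ᘁ)

theorem rightDualAct_evaluation (V : Mod C A) [HasRightDual V.X] :
    rightDualAct V ▷ V.X ≫ ε_ V.X (V.X)ᘁ = (α_ (V.X)ᘁ A V.X).hom ≫ (V.X)ᘁ ◁ V.act ≫ ε_ V.X (V.X)ᘁ :=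
  whiskerRight_curryRight_evaluation _

variable [BraidedCategory C]

/-- The left action of `A` on the left dual of a module, transposed from the right action. -/
def leftDualAct (V : Mod C A) [HasLeftDual V.X] : A ⊗ (ᘁ(V.X)) ⟶ (ᘁ(V.X)) :=
  curryLeft (ᘁ(V.X)) V.X
    ((α_ V.X A (ᘁ(V.X))).inv ≫ rightAct V ▷ (ᘁ(V.X)) ≫ ε_ (ᘁ(V.X)) V.X)

theorem leftDualAct_evaluation (V : Mod C A) [HasLeftDual V.X] :
    V.X ◁ leftDualAct V ≫ ε_ (ᘁ(V.X)) V.X =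
      (α_ V.X A (ᘁ(V.X))).inv ≫ rightAct V ▷ (ᘁ(V.X)) ≫ ε_ (ᘁ(V.X)) V.X :=
  whiskerLeft_curryLeft_evaluation _

variable [IsCommMonObj A]

/-- The module over a commutative algebra given by a right action `r`. It is reducible, so that its
carrier is `Y` on the nose. -/
abbrev modOfRightAct (Y : C) (r : Y ⊗ A ⟶ Y) (hone : Y ◁ η[A] ≫ r = (ρ_ Y).hom)
    (hmul : Y ◁ μ[A] ≫ r = (α_ Y A A).inv ≫ r ▷ A ≫ r) : Mod C A where
  X := Y
  mod :=
    { smul := (β_ A Y).hom ≫ r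
      one_smul := by
        change η[A] ▷ Y ≫ (β_ A Y).hom ≫ r = (λ_ Y).hom
        rw [BraidedCategory.braiding_naturality_left_assoc, hone]
        simp
      mul_smul := by
        change μ[A] ▷ Y ≫ (β_ A Y).hom ≫ r =
          (α_ A A Y).hom ≫ A ◁ ((β_ A Y).hom ≫ r) ≫ (β_ A Y).hom ≫ r
        have braiding_mul : Y ◁ (β_ A A).hom ≫ (α_ Y A A).inv ≫ r ▷ A ≫ r =
            (α_ Y A A).inv ≫ r ▷ A ≫ r := by
          rw [← hmul, ← whiskerLeft_comp_assoc, IsCommMonObj.mul_comm]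
        rw [BraidedCategory.braiding_naturality_left_assoc, hmul, whiskerLeft_comp_assoc,
          BraidedCategory.braiding_naturality_right_assoc,
          BraidedCategory.braiding_tensor_left_hom, BraidedCategory.braiding_tensor_right_hom]
        simp only [Category.assoc]
        rw [braiding_mul] }

/-- The right dual of a module. -/
abbrev rightDualMod (V : Mod C A) [HasRightDual V.X] : Mod C A :=
  modOfRightAct (V.X)ᘁ (rightDualAct V)
    (hom_ext_whiskerRight_evaluation (X := V.X) <| by
      rw [comp_whiskerRight_assoc, rightDualAct_evaluation, associator_naturality_middle_assoc,
        ← whiskerLeft_comp_assoc, one_act, triangle_assoc])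
    (hom_ext_whiskerRight_evaluation (X := V.X) <| by
      simp only [comp_whiskerRight_assoc]
      rw [rightDualAct_evaluation, associator_naturality_middle_assoc,
        ← whiskerLeft_comp_assoc, mul_act, associator_naturality_left_assoc,
        ← whisker_exchange_assoc, rightDualAct_evaluation]
      simp)

theorem rightAct_rightDualMod (V : Mod C A) [HasRightDual V.X] :
    rightAct (rightDualMod V) = rightDualAct V :=
  Iso.inv_hom_id_assoc _ _

theorem isBalanced_rightDualMod (V : Mod C A) [HasRightDual V.X] :
    IsBalanced (rightDualMod V) V (ε_ V.X (V.X)ᘁ) := by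
  rw [IsBalanced, rightAct_rightDualMod]
  exact rightDualAct_evaluation V

/-- The left dual of a module. -/
abbrev leftDualMod (V : Mod C A) [HasLeftDual V.X] : Mod C A where
  X := (ᘁ(V.X))
  mod :=
    { smul := leftDualAct V
      one_smul := hom_ext_whiskerLeft_evaluation (Y := V.X) <| by
        change V.X ◁ (η[A] ▷ (ᘁ(V.X)) ≫ leftDualAct V) ≫ _ = V.X ◁ (λ_ (ᘁ(V.X))).hom ≫ _
        rw [whiskerLeft_comp_assoc, leftDualAct_evaluation, associator_inv_naturality_middle_assoc,
          ← comp_whiskerRight_assoc, one_rightAct, triangle_assoc_comp_right_assoc]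
      mul_smul := hom_ext_whiskerLeft_evaluation (Y := V.X) <| by
        change V.X ◁ (μ[A] ▷ (ᘁ(V.X)) ≫ leftDualAct V) ≫ _ =
          V.X ◁ ((α_ A A (ᘁ(V.X))).hom ≫ A ◁ leftDualAct V ≫ leftDualAct V) ≫ _
        simp only [whiskerLeft_comp_assoc]
        rw [leftDualAct_evaluation, associator_inv_naturality_middle_assoc,
          ← comp_whiskerRight_assoc, mul_rightAct, associator_inv_naturality_right_assoc,
          whisker_exchange_assoc, leftDualAct_evaluation]
        simp }

theorem isBalanced_leftDualMod (V : Mod C A) [HasLeftDual V.X] :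
    IsBalanced V (leftDualMod V) (ε_ (ᘁ(V.X)) V.X) :=
  (Iso.inv_comp_eq _).1 (leftDualAct_evaluation V).symm

end DualModules

namespace EquivMod

variable {C : Type u} [Category.{v} C] [MonoidalCategory C] [BraidedCategory C] {G : Type w}
  [Group G] {A : C} [MonObj A] [IsCommMonObj A] {π : AlgAction G A}

section Right

variable (V : EquivMod π) [HasRightDual V.X]

theorem isSemilinear_rightAdjointMate_ρ (g : G) :
    IsSemilinear (V := rightDualMod V.M) (W := rightDualMod V.M) (π.π g)
      (rightAdjointMate (V.ρ g⁻¹)) := by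
  suffices h : rightDualAct V.M ≫ rightAdjointMate (V.ρ g⁻¹) =
      (rightAdjointMate (V.ρ g⁻¹) ⊗ₘ (π.π g : A ⟶ A)) ≫ rightDualAct V.M by
    change ((β_ A (V.X)ᘁ).hom ≫ rightDualAct V.M) ≫ _ = _ ≫ (β_ A (V.X)ᘁ).hom ≫ rightDualAct V.M
    rw [Category.assoc, h, BraidedCategory.braiding_naturality_assoc]
  apply hom_ext_whiskerRight_evaluation (X := V.X)
  rw [comp_whiskerRight_assoc, rightAdjointMate_comp_evaluation, ← whisker_exchange_assoc,
    rightDualAct_evaluation, comp_whiskerRight_assoc, rightDualAct_evaluation, ← tensorHom_id,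
    associator_naturality_assoc, tensorHom_comp_whiskerLeft_assoc, tensorHom_id,
    MonoidalCategory.tensorHom_def'_assoc, rightAdjointMate_comp_evaluation,
    ← whiskerLeft_comp_assoc, Category.assoc, V.isSemilinear_ρ g⁻¹,
    whiskerRight_comp_tensorHom_assoc, π.π_comp_π_inv, id_tensorHom]
  simp

/-- The right dual of `(V, ρ)` in `𝒟`: the right dual of `V` with `g` acting by the transpose of
`ρ(g⁻¹)`. -/
abbrev rightDualObj : EquivMod π where
  M := rightDualMod V.M
  φ :=
    { toFun g := rightAdjointMate (V.ρ g⁻¹)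
      map_one' := by rw [inv_one, ρ_one]; exact rightAdjointMate_id
      map_mul' g h := by rw [mul_inv_rev, ρ_mul]; exact comp_rightAdjointMate }
  compat g := V.isSemilinear_rightAdjointMate_ρ g

theorem isInvariantPairing_rightDualObj :
    IsInvariantPairing (rightDualObj V) V (ε_ V.X (V.X)ᘁ) where
  balanced := isBalanced_rightDualMod V.M
  invariant g := by
    change (rightAdjointMate (V.ρ g⁻¹) ⊗ₘ V.ρ g) ≫ ε_ V.X (V.X)ᘁ = _
    rw [MonoidalCategory.tensorHom_def'_assoc, rightAdjointMate_comp_evaluation,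
      ← whiskerLeft_comp_assoc, ← ρ_mul, inv_mul_cancel, ρ_one, whiskerLeft_id, Category.id_comp]

end Right

section Left

variable (V : EquivMod π) [HasLeftDual V.X]

theorem isSemilinear_leftAdjointMate_ρ (g : G) :
    IsSemilinear (V := leftDualMod V.M) (W := leftDualMod V.M) (π.π g)
      (leftAdjointMate (V.ρ g⁻¹)) := by
  change leftDualAct V.M ≫ _ = _ ≫ leftDualAct V.M
  apply hom_ext_whiskerLeft_evaluation (Y := V.X)
  rw [whiskerLeft_comp_assoc, leftAdjointMate_comp_evaluation, whisker_exchange_assoc,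
    leftDualAct_evaluation, whiskerLeft_comp_assoc, leftDualAct_evaluation, ← id_tensorHom,
    associator_inv_naturality_assoc, tensorHom_comp_whiskerRight_assoc, id_tensorHom,
    MonoidalCategory.tensorHom_def_assoc, leftAdjointMate_comp_evaluation,
    ← comp_whiskerRight_assoc, Category.assoc, (V.isSemilinear_ρ g⁻¹).rightAct,
    whiskerLeft_comp_tensorHom_assoc, π.π_comp_π_inv, tensorHom_id]
  simp

/-- The left dual of `(V, ρ)` in `𝒟`: the left dual of `V` with `g` acting by the transpose of
`ρ(g⁻¹)`. -/
abbrev leftDualObj : EquivMod π where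
  M := leftDualMod V.M
  φ :=
    { toFun g := leftAdjointMate (V.ρ g⁻¹)
      map_one' := by rw [inv_one, ρ_one]; exact leftAdjointMate_id
      map_mul' g h := by rw [mul_inv_rev, ρ_mul]; exact comp_leftAdjointMate }
  compat g := V.isSemilinear_leftAdjointMate_ρ g

theorem isInvariantPairing_leftDualObj :
    IsInvariantPairing V (leftDualObj V) (ε_ (ᘁ(V.X)) V.X) where
  balanced := isBalanced_leftDualMod V.M
  invariant g := by
    change (V.ρ g ⊗ₘ leftAdjointMate (V.ρ g⁻¹)) ≫ ε_ (ᘁ(V.X)) V.X = _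
    rw [MonoidalCategory.tensorHom_def_assoc, leftAdjointMate_comp_evaluation,
      ← comp_whiskerRight_assoc, ← ρ_mul, inv_mul_cancel, ρ_one, id_whiskerRight, Category.id_comp]

end Left

end EquivMod

section Locality

variable {C : Type u} [Category.{v} C] [MonoidalCategory C] [BraidedCategory C] {A : C} [MonObj A]

theorem isLocal_iff_braiding_act {V : Mod C A} :
    V.IsLocal ↔ (β_ V.X A).hom ≫ V.act = rightAct V := by
  rw [Mod.IsLocal, rightAct, Iso.eq_inv_comp]

theorem isLocal_iff_monodromy_rightAct {V : Mod C A} :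
    V.IsLocal ↔ (β_ V.X A).hom ≫ (β_ A V.X).hom ≫ rightAct V = rightAct V := by
  rw [isLocal_iff_braiding_act, braiding_rightAct]

variable [IsCommMonObj A]

variable (A) in
theorem isLocal_regularMod : (regularMod A).IsLocal := by
  rw [isLocal_iff_braiding_act, regularMod_rightAct, regularMod_act, IsCommMonObj.mul_comm]

variable [HasCoequalizers C] [∀ Z : C, PreservesColimitsOfShape WalkingParallelPair (tensorLeft Z)]
  {V W : Mod C A}

theorem isLocal_relTensor (hV : V.IsLocal) (hW : W.IsLocal) : (relTensor V W).IsLocal := by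
  rw [isLocal_iff_braiding_act] at hV
  rw [Mod.IsLocal, ← cancel_epi (A ◁ relProj V W), BraidedCategory.braiding_naturality_right_assoc,
    BraidedCategory.braiding_naturality_left_assoc, relProj_act,
    BraidedCategory.braiding_tensor_right_hom, BraidedCategory.braiding_tensor_left_hom]
  simp only [Category.assoc, Iso.inv_hom_id_assoc, Iso.hom_inv_id_assoc]
  rw [← comp_whiskerRight_assoc (β_ V.X A).hom, hV, isBalanced_relProj V W,
    Iso.inv_hom_id_assoc, ← whiskerLeft_comp_assoc, ← whiskerLeft_comp_assoc, Category.assoc, hW,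
    ← isBalanced_relProj V W, ← comp_whiskerRight_assoc, braiding_rightAct]

theorem IsBalanced.monodromy_rightAct [ExactPairing A A] {ε : A ⟶ 𝟙_ C} (he : ε_ A A = μ[A] ≫ ε)
    {p : V.X ⊗ W.X ⟶ 𝟙_ C} (hp : IsBalanced V W p) :
    (α_ V.X A W.X).hom ≫ V.X ◁ ((β_ A W.X).hom ≫ (β_ W.X A).hom) ≫ (α_ V.X A W.X).inv ≫
        ((β_ V.X A).hom ≫ (β_ A V.X).hom) ▷ W.X ≫ rightAct V ▷ W.X ≫ p =
      rightAct V ▷ W.X ≫ p := by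
  have h := congrArg (A ◁ relProj V W ≫ ·) (monodromy_act_comp he (relTensor V W) (relDesc p hp))
  rw [BraidedCategory.braiding_naturality_right_assoc,
    BraidedCategory.braiding_naturality_left_assoc, reassoc_of% relProj_act V W, relProj_relDesc,
    BraidedCategory.braiding_tensor_right_hom, BraidedCategory.braiding_tensor_left_hom] at h
  simp only [Category.assoc, Iso.inv_hom_id_assoc, Iso.hom_inv_id_assoc] at h
  rw [cancel_epi, ← braiding_rightAct V, comp_whiskerRight_assoc, cancel_epi] at h
  simpa using h

theorem IsBalanced.isLocal_left [ExactPairing A A] {ε : A ⟶ 𝟙_ C} (he : ε_ A A = μ[A] ≫ ε)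
    [ExactPairing W.X V.X] (hb : IsBalanced V W (ε_ W.X V.X)) (hW : W.IsLocal) : V.IsLocal := by
  have monodromy_W : (α_ V.X A W.X).hom ≫ V.X ◁ ((β_ A W.X).hom ≫ (β_ W.X A).hom) ≫
      (α_ V.X A W.X).inv ≫ rightAct V ▷ W.X ≫ ε_ W.X V.X = rightAct V ▷ W.X ≫ ε_ W.X V.X := by
    rw [hb, Iso.inv_hom_id_assoc, ← whiskerLeft_comp_assoc, Category.assoc, hW]
  have monodromy_V := (hb.monodromy_rightAct he).trans monodromy_W.symm
  rw [cancel_epi, cancel_epi, cancel_epi, ← comp_whiskerRight_assoc, Category.assoc] at monodromy_V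
  exact isLocal_iff_monodromy_rightAct.2 (hom_ext_whiskerRight_evaluation monodromy_V)

theorem IsBalanced.isLocal_right [ExactPairing A A] {ε : A ⟶ 𝟙_ C} (he : ε_ A A = μ[A] ≫ ε)
    [ExactPairing W.X V.X] (hb : IsBalanced V W (ε_ W.X V.X)) (hV : V.IsLocal) : W.IsLocal := by
  have monodromy_W := hb.monodromy_rightAct he
  rw [← comp_whiskerRight_assoc _ (rightAct V), Category.assoc,
    isLocal_iff_monodromy_rightAct.1 hV, hb, Iso.inv_hom_id_assoc, cancel_epi,
    ← whiskerLeft_comp_assoc, Category.assoc] at monodromy_W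
  exact hom_ext_whiskerLeft_evaluation monodromy_W

theorem isLocal_rightDualMod [ExactPairing A A] {ε : A ⟶ 𝟙_ C} (he : ε_ A A = μ[A] ≫ ε)
    [HasRightDual V.X] (hV : V.IsLocal) : (rightDualMod V).IsLocal :=
  (isBalanced_rightDualMod V).isLocal_left he hV

theorem isLocal_leftDualMod [ExactPairing A A] {ε : A ⟶ 𝟙_ C} (he : ε_ A A = μ[A] ≫ ε)
    [HasLeftDual V.X] (hV : V.IsLocal) : (leftDualMod V).IsLocal :=
  (isBalanced_leftDualMod V).isLocal_right he hV

theorem isBalanced_braiding_relProj (hV : V.IsLocal) :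
    IsBalanced V W ((β_ V.X W.X).hom ≫ relProj W V) := by
  have act_relProj := (Iso.eq_inv_comp _).2 (isBalanced_relProj W V).symm
  rw [IsBalanced, BraidedCategory.braiding_naturality_left_assoc,
    BraidedCategory.braiding_naturality_right_assoc, ← isLocal_iff_braiding_act.1 hV,
    whiskerLeft_comp_assoc, ← BraidedCategory.braiding_naturality_left_assoc, act_relProj,
    BraidedCategory.braiding_tensor_left_hom, BraidedCategory.braiding_tensor_right_hom,
    ← braiding_rightAct W, comp_whiskerRight]
  simp

theorem isBalanced_braiding_inv_relProj (hV : V.IsLocal) :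
    IsBalanced W V ((β_ V.X W.X).inv ≫ relProj V W) := by
  have act_relProj := (Iso.eq_inv_comp _).2 (isBalanced_relProj V W).symm
  have act_eq := (Iso.eq_inv_comp _).2 (isLocal_iff_braiding_act.1 hV)
  rw [IsBalanced, BraidedCategory.braiding_inv_naturality_right_assoc, act_eq, rightAct,
    comp_whiskerRight_assoc, BraidedCategory.braiding_inv_naturality_left_assoc, act_relProj,
    BraidedCategory.braiding_tensor_left_inv, BraidedCategory.braiding_tensor_right_inv]
  simp

variable (W) in
/-- The isomorphism `V ⊗_A W ≅ W ⊗_A V` induced by the braiding `R_{VW}`, for `V` local. -/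
noncomputable def relBraiding (hV : V.IsLocal) : (relTensor V W).X ≅ (relTensor W V).X where
  hom := relDesc _ (isBalanced_braiding_relProj hV)
  inv := relDesc _ (isBalanced_braiding_inv_relProj hV)
  hom_inv_id := relTensor_hom_ext <| by
    rw [reassoc_of% relProj_relDesc, Category.assoc, relProj_relDesc, Iso.hom_inv_id_assoc,
      Category.comp_id]
  inv_hom_id := relTensor_hom_ext <| by
    rw [reassoc_of% relProj_relDesc, Category.assoc, relProj_relDesc, Iso.inv_hom_id_assoc,
      Category.comp_id]

theorem relProj_relBraiding_hom (hV : V.IsLocal) :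
    relProj V W ≫ (relBraiding W hV).hom = (β_ V.X W.X).hom ≫ relProj W V :=
  relProj_relDesc _ (isBalanced_braiding_relProj hV)

theorem isSemilinear_relBraiding_hom (hV : V.IsLocal) :
    IsSemilinear (𝟙 A) (relBraiding W hV).hom := by
  have act_relProj := (Iso.eq_inv_comp _).2 (isBalanced_relProj W V).symm
  rw [isSemilinear_relTensor_iff, relProj_relBraiding_hom,
    BraidedCategory.braiding_naturality_left_assoc, id_tensorHom, whiskerLeft_comp_assoc,
    relProj_act, act_relProj, BraidedCategory.braiding_tensor_left_hom, ← braiding_rightAct W,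
    comp_whiskerRight]
  simp

end Locality

namespace EquivMod

section Braiding

variable {C : Type u} [Category.{v} C] [MonoidalCategory C] [BraidedCategory C] {G : Type w}
  [Group G] {A : C} [MonObj A] {π : AlgAction G A} [IsCommMonObj A] [HasCoequalizers C]
  [∀ Z : C, PreservesColimitsOfShape WalkingParallelPair (tensorLeft Z)]

instance : (isLocal π).IsMonoidal where
  prop_unit := isLocal_regularMod A
  prop_tensor _ _ := isLocal_relTensor

/-- The braiding `V ⊗_A W ≅ W ⊗_A V` of `𝒟`, for `V` local. -/
noncomputable def braidIso {V : EquivMod π} (hV : V.M.IsLocal) (W : EquivMod π) :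
    V ⊗ W ≅ W ⊗ V :=
  isoMk (relBraiding W.M hV) (isSemilinear_relBraiding_hom hV) fun g =>
    (cancel_epi (proj V W)).1 <| by
      have proj_relBraiding_hom :
          proj V W ≫ (relBraiding W.M hV).hom = (β_ V.X W.X).hom ≫ proj W V :=
        relProj_relBraiding_hom hV
      rw [reassoc_of% proj_ρ, proj_relBraiding_hom, reassoc_of% proj_relBraiding_hom, proj_ρ,
        BraidedCategory.braiding_naturality_assoc]

theorem proj_braidIso_hom {V : EquivMod π} (hV : V.M.IsLocal) (W : EquivMod π) :
    proj V W ≫ toC (braidIso hV W).hom = (β_ V.X W.X).hom ≫ proj W V :=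
  relProj_relBraiding_hom hV

section Hexagon

variable {U : EquivMod π} (hU : U.M.IsLocal)

theorem whiskerLeft_braidIso_hom {V W : EquivMod π} (f : V ⟶ W) :
    U ◁ f ≫ (braidIso hU W).hom = (braidIso hU V).hom ≫ f ▷ U :=
  tensorObj_hom_ext <| by
    rw [toC_comp, toC_comp, reassoc_of% proj_whiskerLeft, proj_braidIso_hom,
      reassoc_of% proj_braidIso_hom, proj_whiskerRight,
      BraidedCategory.braiding_naturality_right_assoc]

theorem whiskerRight_braidIso_hom {V : EquivMod π} (hV : V.M.IsLocal) (f : U ⟶ V)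
    (W : EquivMod π) : f ▷ W ≫ (braidIso hV W).hom = (braidIso hU W).hom ≫ W ◁ f :=
  tensorObj_hom_ext <| by
    rw [toC_comp, toC_comp, reassoc_of% proj_whiskerRight, proj_braidIso_hom,
      reassoc_of% proj_braidIso_hom, proj_whiskerLeft,
      BraidedCategory.braiding_naturality_left_assoc]

theorem braidIso_hexagon_forward (V W : EquivMod π) :
    (α_ U V W).hom ≫ (braidIso hU (V ⊗ W)).hom ≫ (α_ V W U).hom =
      (braidIso hU V).hom ▷ W ≫ (α_ V U W).hom ≫ V ◁ (braidIso hU W).hom := by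
  refine tensorObj_hom_ext₃ ?_
  simp only [toC_comp]
  rw [reassoc_of% proj_associator_hom, reassoc_of% proj_braidIso_hom,
    BraidedCategory.braiding_naturality_right_assoc, proj_associator_hom,
    reassoc_of% proj_whiskerRight, ← comp_whiskerRight_assoc, proj_braidIso_hom,
    comp_whiskerRight_assoc, reassoc_of% proj_associator_hom, proj_whiskerLeft,
    ← whiskerLeft_comp_assoc, proj_braidIso_hom, whiskerLeft_comp_assoc]
  simp

theorem braidIso_hexagon_reverse {V : EquivMod π} (hV : V.M.IsLocal) (hUV : (U ⊗ V).M.IsLocal)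
    (W : EquivMod π) :
    (α_ U V W).inv ≫ (braidIso hUV W).hom ≫ (α_ W U V).inv =
      U ◁ (braidIso hV W).hom ≫ (α_ U W V).inv ≫ (braidIso hU W).hom ▷ V := by
  refine tensorObj_hom_ext ((cancel_epi (U.X ◁ proj V W)).1 ?_)
  simp only [toC_comp]
  rw [reassoc_of% proj_associator_inv, reassoc_of% proj_braidIso_hom,
    BraidedCategory.braiding_naturality_left_assoc, proj_associator_inv,
    reassoc_of% proj_whiskerLeft, ← whiskerLeft_comp_assoc, proj_braidIso_hom,
    whiskerLeft_comp_assoc, reassoc_of% proj_associator_inv, proj_whiskerRight,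
    ← comp_whiskerRight_assoc, proj_braidIso_hom, comp_whiskerRight_assoc]
  simp

end Hexagon

noncomputable instance : BraidedCategory (isLocal π).FullSubcategory where
  braiding V W := (isLocal π).isoMk (braidIso V.property W.obj)
  braiding_naturality_right U _ _ f :=
    ObjectProperty.hom_ext _ (whiskerLeft_braidIso_hom U.property f.hom)
  braiding_naturality_left {U V} f W :=
    ObjectProperty.hom_ext _ (whiskerRight_braidIso_hom U.property V.property f.hom W.obj)
  hexagon_forward U V W :=
    ObjectProperty.hom_ext _ (braidIso_hexagon_forward U.property V.obj W.obj)
  hexagon_reverse U V W := ObjectProperty.hom_ext _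
    (braidIso_hexagon_reverse U.property V.property (U ⊗ V).property W.obj)

theorem proj_braiding_hom (V W : (isLocal π).FullSubcategory) :
    proj V.obj W.obj ≫ toC (β_ V W).hom.hom = (β_ V.obj.X W.obj.X).hom ≫ proj W.obj V.obj :=
  proj_braidIso_hom V.property W.obj

end Braiding

end EquivMod

section Twist

variable {C : Type u} [Category.{v} C] [MonoidalCategory C] [BraidedCategory C] {t : BraidedTwist C}

theorem BraidedTwist.naturality (t : BraidedTwist C) {X Y : C} (f : X ⟶ Y) :
    f ≫ t.app Y = t.app X ≫ f :=
  t.θ.hom.naturality f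

theorem BraidedTwist.app_tensor (t : BraidedTwist C) (X Y : C) :
    t.app (X ⊗ Y) = (t.app X ⊗ₘ t.app Y) ≫ (β_ X Y).hom ≫ (β_ Y X).hom :=
  t.tensor X Y

theorem isSemilinear_twist {A : C} [MonObj A] (hθ : t.app A = 𝟙 A) {V : Mod C A}
    (hV : V.IsLocal) : IsSemilinear (V := V) (W := V) (𝟙 A) (t.app V.X) := by
  rw [IsSemilinear.id_iff, t.naturality, t.app_tensor, hθ, id_tensorHom, Category.assoc,
    Category.assoc, hV]

namespace EquivMod

variable {G : Type w} [Group G] {A : C} [MonObj A] {π : AlgAction G A} (hθ : t.app A = 𝟙 A)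

/-- The balancing `θ_V` of `C` as an automorphism of a local object `V` of `𝒟`. -/
def twistIso {V : EquivMod π} (hV : V.M.IsLocal) : V ≅ V :=
  isoMk (t.θ.app V.X) (isSemilinear_twist hθ hV) fun g => t.naturality (V.ρ g)

variable [IsCommMonObj A] [HasCoequalizers C]
  [∀ Z : C, PreservesColimitsOfShape WalkingParallelPair (tensorLeft Z)]

variable (π) in
/-- The balancing of `𝒟⁰`, given by the balancing of `C` on underlying objects. -/
def localTwist : BraidedTwist (isLocal π).FullSubcategory where
  θ := NatIso.ofComponents (fun V => (isLocal π).isoMk (twistIso hθ V.property))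
    fun f => ObjectProperty.hom_ext _ (hom_ext' (t.naturality (toC f.hom)))
  tensor V W := ObjectProperty.hom_ext _ <| tensorObj_hom_ext <| by
    change proj V.obj W.obj ≫ t.app (V.obj ⊗ W.obj).X = proj V.obj W.obj ≫
      toC ((twistIso hθ V.property).hom ⊗ₘ (twistIso hθ W.property).hom) ≫
      toC (β_ V W).hom.hom ≫ toC (β_ W V).hom.hom
    rw [reassoc_of% proj_tensorHom, reassoc_of% proj_braiding_hom, proj_braiding_hom,
      t.naturality, t.app_tensor, Category.assoc, Category.assoc]
    rfl

theorem toC_localTwist_app (V : (isLocal π).FullSubcategory) :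
    toC ((localTwist π hθ).app V).hom = t.app V.obj.X :=
  rfl

end EquivMod

end Twist

section FullSubcategory

variable {D : Type u} [Category.{v} D] [MonoidalCategory D] (P : ObjectProperty D) [P.IsMonoidal]

/-- A dual pair of `D` whose objects lie in a monoidal full subcategory is a dual pair there. -/
abbrev exactPairingFullSubcategory (V W : P.FullSubcategory) [ExactPairing V.obj W.obj] :
    ExactPairing V W where
  coevaluation' := ObjectProperty.homMk (η_ V.obj W.obj)
  evaluation' := ObjectProperty.homMk (ε_ V.obj W.obj)
  coevaluation_evaluation' :=
    ObjectProperty.hom_ext _ (ExactPairing.coevaluation_evaluation V.obj W.obj)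
  evaluation_coevaluation' :=
    ObjectProperty.hom_ext _ (ExactPairing.evaluation_coevaluation V.obj W.obj)

/-- The rigid structure of a monoidal full subcategory closed under the duals of `D`. -/
abbrev rigidCategoryFullSubcategory [RigidCategory D] (hr : ∀ V, P V → P (Vᘁ))
    (hl : ∀ V : D, P V → P (ᘁV)) : RigidCategory P.FullSubcategory where
  rightDual V :=
    { rightDual := ⟨(V.obj)ᘁ, hr _ V.property⟩
      exact := exactPairingFullSubcategory P V ⟨(V.obj)ᘁ, hr _ V.property⟩ }
  leftDual V :=
    { leftDual := ⟨ᘁ(V.obj), hl _ V.property⟩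
      exact := exactPairingFullSubcategory P ⟨ᘁ(V.obj), hl _ V.property⟩ V }

end FullSubcategory

instance {J : Type*} [Category* J] {C : Type u} [Category.{v} C] [MonoidalCategory C] (Z : C)
    [HasLeftDual Z] : PreservesColimitsOfShape J (tensorLeft Z) :=
  (tensorLeftAdjunction (ᘁZ) Z).leftAdjoint_preservesColimits.preservesColimitsOfShape

namespace EquivMod

section Rigid

variable {C : Type u} [Category.{v} C] [MonoidalCategory C] [BraidedCategory C] {G : Type w}
  [Group G] {A : C} [MonObj A] {π : AlgAction G A} [IsCommMonObj A] [HasCoequalizers C]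
  [RigidCategory C] [Preadditive C] [Linear ℂ C] [MonoidalPreadditive C] [MonoidalLinear ℂ C]
  [ExactPairing A A] {ε : A ⟶ 𝟙_ C} (he : ε_ A A = μ[A] ≫ ε)
  (hε : ∀ g, (π.π g : A ⟶ A) ≫ ε = ε) {c : ℂ} (hc : η_ A A ≫ μ[A] = c • η[A]) (hc0 : c ≠ 0)

/-- The rigid structure of `𝒟`, whose duals are those of `C`. -/
noncomputable abbrev rigidCategory : RigidCategory (EquivMod π) where
  rightDual V :=
    { rightDual := rightDualObj V
      exact := exactPairing he hε (isInvariantPairing_rightDualObj V) hc hc0 }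
  leftDual V :=
    { leftDual := leftDualObj V
      exact := exactPairing he hε (isInvariantPairing_leftDualObj V) hc hc0 }

theorem proj_evaluation_counit (V : EquivMod π) :
    letI := rigidCategory he hε hc hc0
    proj (Vᘁ) V ≫ (toC (ε_ V (Vᘁ)) : _ ⟶ A) ≫ ε = ε_ V.X (V.X)ᘁ :=
  proj_pairing_counit he hε (isInvariantPairing_rightDualObj V)

theorem isNaturalDual_rightDual (V : EquivMod π) :
    letI := rigidCategory he hε hc hc0
    IsNaturalDual proj unitIso ε V (Vᘁ) (ε_ V (Vᘁ)) (Iso.refl ((V.X)ᘁ)) := by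
  let := rigidCategory he hε hc hc0
  have id_whiskerRight_evaluation : 𝟙 ((V.X)ᘁ) ▷ V.X ≫ ε_ V.X (V.X)ᘁ = ε_ V.X (V.X)ᘁ := by
    rw [id_whiskerRight, Category.id_comp]
  have comp_id_counit : proj (Vᘁ) V ≫ (toC (ε_ V (Vᘁ)) : _ ⟶ A) ≫ 𝟙 A ≫ ε =
      proj (Vᘁ) V ≫ (toC (ε_ V (Vᘁ)) : _ ⟶ A) ≫ ε :=
    congrArg (fun k => proj (Vᘁ) V ≫ (toC (ε_ V (Vᘁ)) : _ ⟶ A) ≫ k) (Category.id_comp ε)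
  exact
    { action := fun _ => (Category.comp_id _).trans (Category.id_comp _).symm
      evaluation := comp_id_counit.trans <|
        (proj_evaluation_counit he hε hc hc0 V).trans id_whiskerRight_evaluation.symm }

/-- The rigid structure of `𝒟⁰`, with the duals of `𝒟`. -/
noncomputable abbrev rigidCategoryLocal : RigidCategory (isLocal π).FullSubcategory :=
  letI := rigidCategory he hε hc hc0
  rigidCategoryFullSubcategory (isLocal π) (fun _ => isLocal_rightDualMod he)
    fun _ => isLocal_leftDualMod he

theorem isRibbon_localTwist {t : BraidedTwist C} (hθ : t.app A = 𝟙 A) (ht : t.IsRibbon) :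
    letI := rigidCategoryLocal he hε hc hc0
    (localTwist π hθ).IsRibbon := by
  let := rigidCategory he hε hc hc0
  let := rigidCategoryLocal he hε hc hc0
  intro V
  have proj_evaluation := proj_evaluation_counit he hε hc hc0 V.obj
  let θV := (twistIso hθ V.property).hom
  let θV' := (twistIso hθ (isLocal_rightDualMod he V.property) : V.objᘁ ≅ V.objᘁ).hom
  apply hom_ext_whiskerRight_evaluation (X := V)
  rw [rightAdjointMate_comp_evaluation]
  refine ObjectProperty.hom_ext _ (hom_ext_counit he ((cancel_epi (proj (V.objᘁ) V.obj)).1 ?_))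
  have transpose_twist : t.app (V.obj.X)ᘁ ▷ V.obj.X ≫ ε_ V.obj.X (V.obj.X)ᘁ =
      (V.obj.X)ᘁ ◁ t.app V.obj.X ≫ ε_ V.obj.X (V.obj.X)ᘁ := by
    rw [ht, rightAdjointMate_comp_evaluation]
  calc proj (V.objᘁ) V.obj ≫ (toC (θV' ▷ V.obj) ≫ (toC (ε_ V.obj (V.objᘁ)) : _ ⟶ A)) ≫ ε
      = t.app (V.obj.X)ᘁ ▷ V.obj.X ≫ ε_ V.obj.X (V.obj.X)ᘁ := by
        rw [Category.assoc, reassoc_of% proj_whiskerRight, proj_evaluation]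
        rfl
    _ = proj (V.objᘁ) V.obj ≫ (toC (V.objᘁ ◁ θV) ≫ (toC (ε_ V.obj (V.objᘁ)) : _ ⟶ A)) ≫ ε := by
        rw [transpose_twist, Category.assoc, reassoc_of% proj_whiskerLeft, proj_evaluation]
        rfl

end Rigid

end EquivMod

theorem mainTheorem12_general
    {C : Type u} [Category.{v} C] [Abelian C] [Linear ℂ C] [MonoidalCategory C]
    [MonoidalPreadditive C] [MonoidalLinear ℂ C] [RigidCategory C] [BraidedCategory C]
    (hfin : ∀ X Y : C, FiniteDimensional ℂ (X ⟶ Y))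
    (t : BraidedTwist C)
    (A : C) [MonObj A] (ε : A ⟶ 𝟙_ C) (hA : IsRigidCommAlgebra t A ε) (hθ : t.app A = 𝟙 A)
    {G : Type w} [Group G] (π : AlgAction G A) :
    ∃ (_ : MonoidalCategory (EquivMod π))
      (p : ∀ V W : EquivMod π, V.X ⊗ W.X ⟶ (V ⊗ W).X)
      (e : 𝟙_ (EquivMod π) ≅ EquivMod.algObj π)
      (_ : RigidCategory (EquivMod π)),
      EquivMod.IsNaturalTensor p e ∧
      IsTensorCategory (EquivMod π) ∧
      (∀ V : EquivMod π, ∃ d : (Vᘁ).X ≅ (V.X)ᘁ,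
        EquivMod.IsNaturalDual p e ε V (Vᘁ) (ε_ V (Vᘁ)) d) ∧
      (∀ V : EquivMod π, V.M.IsLocal → (Vᘁ).M.IsLocal ∧ (ᘁV).M.IsLocal) ∧
      ∃ _ : (EquivMod.isLocal π).IsMonoidal,
        IsTensorCategory (EquivMod.isLocal π).FullSubcategory ∧
        ∃ (_ : RigidCategory (EquivMod.isLocal π).FullSubcategory)
          (_ : BraidedCategory (EquivMod.isLocal π).FullSubcategory)
          (t₀ : BraidedTwist (EquivMod.isLocal π).FullSubcategory),
          (∀ V W : (EquivMod.isLocal π).FullSubcategory,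
            p V.obj W.obj ≫ EquivMod.toC (β_ V W).hom.hom =
              (β_ V.obj.X W.obj.X).hom ≫ p W.obj V.obj) ∧
          (∀ V : (EquivMod.isLocal π).FullSubcategory,
            EquivMod.toC (t₀.app V).hom = t.app V.obj.X) ∧
          (t.IsRibbon → t₀.IsRibbon) := by
  obtain ⟨hcomm, hhaploid, hcounit, ⟨selfDual, he⟩, hdim⟩ := hA
  let : ExactPairing A A := selfDual
  have hε := AlgAction.comp_counit hhaploid hcounit he π
  obtain ⟨c, hc0, hc⟩ := exists_coevaluation_mul_eq_smul_one hhaploid hθ he hdim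
  let := EquivMod.rigidCategory he hε hc hc0
  exact ⟨inferInstance, EquivMod.proj, EquivMod.unitIso, EquivMod.rigidCategory he hε hc hc0,
    EquivMod.isNaturalTensor_proj, EquivMod.isTensorCategory π hfin hhaploid,
    fun V => ⟨Iso.refl _, EquivMod.isNaturalDual_rightDual he hε hc hc0 V⟩,
    fun V hV => ⟨isLocal_rightDualMod he hV, isLocal_leftDualMod he hV⟩,
    inferInstance, EquivMod.isTensorCategory_isLocal π hfin hhaploid,
    EquivMod.rigidCategoryLocal he hε hc hc0, inferInstance, EquivMod.localTwist π hθ,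
    EquivMod.proj_braiding_hom, EquivMod.toC_localTwist_app hθ,
    EquivMod.isRibbon_localTwist he hε hc hc0 hθ⟩

theorem mainTheorem12
    {C : Type u} [Category.{v} C] [Abelian C] [Linear ℂ C] [MonoidalCategory C]
    [MonoidalPreadditive C] [MonoidalLinear ℂ C] [RigidCategory C] [BraidedCategory C]
    (hfin : ∀ X Y : C, FiniteDimensional ℂ (X ⟶ Y))
    (hss : IsSemisimpleCategory C) (hunit : Simple (𝟙_ C))
    (t : BraidedTwist C)
    (A : C) [MonObj A] (ε : A ⟶ 𝟙_ C) (hA : IsRigidCommAlgebra t A ε) (hθ : t.app A = 𝟙 A)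
    {G : Type w} [Group G] [Finite G] (π : AlgAction G A)
    (hfaithful : Function.Injective π.π) (hinv : π.InvariantsEqUnit) :
    ∃ (_ : MonoidalCategory (EquivMod π))
      (p : ∀ V W : EquivMod π, V.X ⊗ W.X ⟶ (V ⊗ W).X)
      (e : 𝟙_ (EquivMod π) ≅ EquivMod.algObj π)
      (_ : RigidCategory (EquivMod π)),
      -- `𝒟` is a rigid tensor category with the stated tensor product and duals
      EquivMod.IsNaturalTensor p e ∧
      IsTensorCategory (EquivMod π) ∧
      (∀ V : EquivMod π, ∃ d : (Vᘁ).X ≅ (V.X)ᘁ,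
        EquivMod.IsNaturalDual p e ε V (Vᘁ) (ε_ V (Vᘁ)) d) ∧
      -- `𝒟⁰` is closed under `⊗`, the unit and duals, ...
      (∀ V : EquivMod π, V.M.IsLocal → (Vᘁ).M.IsLocal ∧ (ᘁV).M.IsLocal) ∧
      ∃ _ : (EquivMod.isLocal π).IsMonoidal,
        IsTensorCategory (EquivMod.isLocal π).FullSubcategory ∧
        -- ... and is a balanced rigid braided category, with braiding and twist those of `C`
        ∃ (_ : RigidCategory (EquivMod.isLocal π).FullSubcategory)
          (_ : BraidedCategory (EquivMod.isLocal π).FullSubcategory)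
          (t₀ : BraidedTwist (EquivMod.isLocal π).FullSubcategory),
          (∀ V W : (EquivMod.isLocal π).FullSubcategory,
            p V.obj W.obj ≫ EquivMod.toC (β_ V W).hom.hom =
              (β_ V.obj.X W.obj.X).hom ≫ p W.obj V.obj) ∧
          (∀ V : (EquivMod.isLocal π).FullSubcategory,
            EquivMod.toC (t₀.app V).hom = t.app V.obj.X) ∧
          (t.IsRibbon → t₀.IsRibbon) :=
  mainTheorem12_general hfin t A ε hA hθ π
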